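/- **Lemma.** Let $\mathbf{D}$ be a small category. A *diagram of model categories* $\mathcal{M}$ indexed by $\mathbf{D}$ assigns to each object $s$ a (complete and cocomplete) model category $\mathcal{M}(s)$ and to each map $a:s\to t$ a left Quillen functor $a_*:\mathcal{M}(s)\to\mathcal{M}(t)$, compatibly with identities and composition up to coherent natural isomorphism (i.e. $\mathcal{M}$ is a pseudofunctor $\mathbf{D}\to\mathrm{Cat}$; strict functors are a special case). An *$\mathcal{M}$-diagram* $X$ consists of objects $X(s)\in\mathcal{M}(s)$ and maps $\widetilde X(a):a_*X(s)\to X(t)$ for all $a:s\to t$ in $\mathbf{D}$, compatible with identities and composition; a map of $\mathcal{M}$-diagrams $X\to Y$ consists of maps $X(s)\to Y(s)$ in $\mathcal{M}(s)$ commuting with the structure maps. A *map of diagrams of model categories* $L:\mathcal{M}\to\mathcal{N}$ is a (pseudo)natural transformation, i.e. it consists of functors $L(s):\mathcal{M}(s)\to\mathcal{N}(s)$ and coherent natural isomorphisms $a_*L(s)\cong L(t)a_*$. It induces a functor from $\mathcal{M}$-diagrams to $\mathcal{N}$-diagrams, sending $X$ to $s\mapsto L(s)X(s)$ with structure maps $a_*L(s)X(s)\cong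 L(t)a_*X(s)\to L(t)X(t)$. The category $\mathbf{D}$ is *direct* if there is a functor $d$ from $\mathbf{D}$ to the ordinals with $d(s)<d(t)$ whenever there is a non-identity map $s\to t$, and *inverse* if $\mathbf{D}^{op}$ is direct. The *diagram-projective* (resp. *diagram-injective*) model structure on $\mathcal{M}$-diagrams is the one whose weak equivalences and fibrations (resp. weak equivalences and cofibrations) are defined objectwise. Let $L:\mathcal{M}\to\mathcal{N}$ be a map of diagrams of model categories indexed by $\mathbf{D}$ such that each $L(s):\mathcal{M}(s)\to\mathcal{N}(s)$ is a left Quillen equivalence (the left adjoint of a Quillen equivalence). 1. If $\mathbf{D}$ is direct, then the diagram-projective model structures on $\mathcal{M}$-diagrams and on $\mathcal{N}$-diagrams exist, and the functor induced by $L$ from $\mathcal{M}$-diagrams to $\mathcal{N}$-diagrams is a left Quillen equivalence between them. 2. If $\mathbf{D}$ is inverse, then the diagram-injective model structures on $\mathcal{M}$-diagrams and on $\mathcal{N}$-diagrams exist, and the functor induced by $L$ from $\mathcal{M}$-diagrams to $\mathcal{N}$-diagrams is a left Quillen equivalence between them. -/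

import Mathlib

open CategoryTheory Limits HomotopicalAlgebra

universe w v u v₁ u₁ v₂ u₂

/-! ### Quillen adjunctions and Quillen equivalences -/

section Quillen

variable {C : Type u₁} [Category.{v₁} C] [ModelCategory C]
  {D : Type u₂} [Category.{v₂} D] [ModelCategory D]

/-- An adjunction `F ⊣ G` between model categories is a Quillen adjunction if the left adjoint
preserves cofibrations and trivial cofibrations. -/
structure IsQuillenAdjunction {F : C ⥤ D} {G : D ⥤ C} (adj : F ⊣ G) : Prop where
  map_cofibration : ∀ ⦃X Y : C⦄ (f : X ⟶ Y), cofibrations C f → cofibrations D (F.map f)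
  map_trivialCofibration : ∀ ⦃X Y : C⦄ (f : X ⟶ Y),
    trivialCofibrations C f → trivialCofibrations D (F.map f)

/-- A Quillen adjunction `F ⊣ G` is a Quillen equivalence if, for all cofibrant `X` and all
fibrant `Y`, a map `F X ⟶ Y` is a weak equivalence if and only if its adjunct `X ⟶ G Y` is. -/
structure IsQuillenEquivalence {F : C ⥤ D} {G : D ⥤ C} (adj : F ⊣ G) : Prop
    extends IsQuillenAdjunction adj where
  weakEquivalence_iff : ∀ (X : C) (Y : D), IsCofibrant X → IsFibrant Y →
    ∀ f : F.obj X ⟶ Y, WeakEquivalence f ↔ WeakEquivalence (adj.homEquiv X Y f)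

/-- A left Quillen functor: the left adjoint of a Quillen adjunction. -/
def IsLeftQuillen (F : C ⥤ D) : Prop :=
  ∃ (G : D ⥤ C) (adj : F ⊣ G), IsQuillenAdjunction adj

/-- A left Quillen equivalence: the left adjoint of a Quillen equivalence. -/
def IsLeftQuillenEquivalence (F : C ⥤ D) : Prop :=
  ∃ (G : D ⥤ C) (adj : F ⊣ G), IsQuillenEquivalence adj

end Quillen

/-! ### Direct and inverse categories -/

/-- `D` is a direct category if it has a linear extension: a functor `d` to the ordinals that
sends every non-identity map to a non-identity map, i.e. strictly raises the degree along it. -/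
def IsDirectCategory (D : Type w) [SmallCategory D] : Prop :=
  ∃ d : D ⥤ Ordinal.{w}, ∀ ⦃s t : D⦄ (a : s ⟶ t),
    (¬ ∃ h : s = t, a = eqToHom h) → d.obj s < d.obj t

/-- `D` is an inverse category if its opposite is a direct category. -/
def IsInverseCategory (D : Type w) [SmallCategory D] : Prop :=
  IsDirectCategory Dᵒᵖ

/-! ### Diagrams over a diagram of categories -/

section Diagrams

variable {D : Type w} [SmallCategory D]

/-- A diagram over `F : D → Cat`: objects `X(s)` of `F(s)` and maps `a_* X(s) ⟶ X(t)` for all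
`a : s ⟶ t`, compatible with identities and composition, where `a_*` is the functor `F(a)`. -/
structure CatDiagram (F : Pseudofunctor (LocallyDiscrete D) Cat.{v, u}) where
  obj (s : D) : F.obj ⟨s⟩
  map {s t : D} (a : s ⟶ t) : (F.map a.toLoc).toFunctor.obj (obj s) ⟶ obj t
  map_id (s : D) : map (𝟙 s) = (F.mapId ⟨s⟩).hom.toNatTrans.app (obj s)
  map_comp {r s t : D} (a : r ⟶ s) (b : s ⟶ t) :
    map (a ≫ b) = (F.mapComp a.toLoc b.toLoc).hom.toNatTrans.app (obj r) ≫
      (F.map b.toLoc).toFunctor.map (map a) ≫ map b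

namespace CatDiagram

variable {F : Pseudofunctor (LocallyDiscrete D) Cat.{v, u}}

/-- A map of diagrams: maps `X(s) ⟶ Y(s)` in `F(s)` compatible with the structure maps. -/
@[ext]
structure Hom (X Y : CatDiagram F) where
  app (s : D) : X.obj s ⟶ Y.obj s
  naturality {s t : D} (a : s ⟶ t) :
    X.map a ≫ app t = (F.map a.toLoc).toFunctor.map (app s) ≫ Y.map a

instance : Category (CatDiagram F) where
  Hom X Y := Hom X Y
  id X := { app := fun _ => 𝟙 _, naturality := by simp }
  comp f g :=
    { app := fun s => f.app s ≫ g.app s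
      naturality := fun a => by
        rw [← Category.assoc, f.naturality, Category.assoc, g.naturality, Functor.map_comp,
          Category.assoc] }
  id_comp f := Hom.ext (funext fun _ => Category.id_comp _)
  comp_id f := Hom.ext (funext fun _ => Category.comp_id _)
  assoc f g h := Hom.ext (funext fun _ => Category.assoc _ _ _)

@[simp] theorem id_app (X : CatDiagram F) (s : D) : Hom.app (𝟙 X) s = 𝟙 (X.obj s) := rfl

@[simp] theorem comp_app {X Y Z : CatDiagram F} (f : X ⟶ Y) (g : Y ⟶ Z) (s : D) :
    Hom.app (f ≫ g) s = Hom.app f s ≫ Hom.app g s := rfl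

variable {G : Pseudofunctor (LocallyDiscrete D) Cat.{v, u}}

theorem naturality_id_inv_app (L : Pseudofunctor.StrongTrans F G) (s : D) (x : F.obj ⟨s⟩) :
    (L.naturality (𝟙 (⟨s⟩ : LocallyDiscrete D))).inv.toNatTrans.app x ≫
      (L.app ⟨s⟩).toFunctor.map ((F.mapId ⟨s⟩).hom.toNatTrans.app x) =
        (G.mapId ⟨s⟩).hom.toNatTrans.app ((L.app ⟨s⟩).toFunctor.obj x) := by
  have h := congrArg (fun φ => φ.toNatTrans.app x) (L.naturality_id ⟨s⟩)
  simp [-Pseudofunctor.StrongTrans.naturality_id] at h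
  rw [← h]
  exact Cat.Hom.inv_hom_id_toNatTrans_app_assoc _ _ _

theorem cancel_aux {E : Type u₁} [Category.{v₁} E] {A B K S Q Y : E} {p : A ⟶ B} {p' : B ⟶ A}
    {c : B ⟶ Q} {m : A ⟶ S} {n : S ⟶ K} {n' : K ⟶ S} {q : K ⟶ Q} {q' : Q ⟶ K}
    (hp : p' ≫ p = 𝟙 B) (h : p ≫ c = m ≫ n ≫ q) (hn : n ≫ n' = 𝟙 S) (hq : q ≫ q' = 𝟙 K)
    (g : S ⟶ Y) : p' ≫ m ≫ g = c ≫ q' ≫ n' ≫ g := by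
  have hc : c = p' ≫ m ≫ n ≫ q := by rw [← h, reassoc_of% hp]
  rw [hc]
  simp only [Category.assoc]
  rw [reassoc_of% hq, reassoc_of% hn]

theorem naturality_comp_inv_app (L : Pseudofunctor.StrongTrans F G) {r s t : D}
    (a : r ⟶ s) (b : s ⟶ t) (x : F.obj ⟨r⟩) {y : F.obj ⟨t⟩}
    (g : (F.map b.toLoc).toFunctor.obj ((F.map a.toLoc).toFunctor.obj x) ⟶ y) :
    (L.naturality (a.toLoc ≫ b.toLoc)).inv.toNatTrans.app x ≫
      (L.app ⟨t⟩).toFunctor.map ((F.mapComp a.toLoc b.toLoc).hom.toNatTrans.app x ≫ g) =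
    (G.mapComp a.toLoc b.toLoc).hom.toNatTrans.app ((L.app ⟨r⟩).toFunctor.obj x) ≫
      (G.map b.toLoc).toFunctor.map ((L.naturality a.toLoc).inv.toNatTrans.app x) ≫
        (L.naturality b.toLoc).inv.toNatTrans.app ((F.map a.toLoc).toFunctor.obj x) ≫
          (L.app ⟨t⟩).toFunctor.map g := by
  have h := congrArg (fun φ => φ.toNatTrans.app x) (L.naturality_comp a.toLoc b.toLoc)
  simp [-Pseudofunctor.StrongTrans.naturality_comp] at h
  have e₁ := Cat.Hom.hom_inv_id_toNatTrans_app (L.naturality b.toLoc)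
    ((F.map a.toLoc).toFunctor.obj x)
  have e₂ := congrArg (G.map b.toLoc).toFunctor.map
    (Cat.Hom.hom_inv_id_toNatTrans_app (L.naturality a.toLoc) x)
  rw [Functor.map_comp, CategoryTheory.Functor.map_id] at e₂
  rw [Functor.map_comp]
  exact cancel_aux (Cat.Hom.inv_hom_id_toNatTrans_app (L.naturality (a.toLoc ≫ b.toLoc)) x)
    h e₁ e₂ _

/-- The diagram induced by a diagram `X` and a (pseudo)natural transformation `L` from `F` to `G`:
it is `s ↦ L(s) X(s)`, with structure maps `a_* L(s) X(s) ≅ L(t) a_* X(s) ⟶ L(t) X(t)`. -/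
def mapObj (L : Pseudofunctor.StrongTrans F G) (X : CatDiagram F) : CatDiagram G where
  obj s := (L.app ⟨s⟩).toFunctor.obj (X.obj s)
  map {s t} a := (L.naturality a.toLoc).inv.toNatTrans.app (X.obj s) ≫
    (L.app ⟨t⟩).toFunctor.map (X.map a)
  map_id s := by
    rw [X.map_id]
    exact naturality_id_inv_app L s (X.obj s)
  map_comp {r s t} a b := by
    have n := (L.naturality b.toLoc).inv.toNatTrans.naturality (X.map a)
    dsimp at n
    rw [X.map_comp]
    refine (naturality_comp_inv_app L a b (X.obj r) _).trans ?_
    rw [Functor.map_comp, Functor.map_comp, Category.assoc, reassoc_of% n]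

/-- The functor induced on diagrams by a (pseudo)natural transformation `L` from `F` to `G`. -/
def mapFunctor (L : Pseudofunctor.StrongTrans F G) : CatDiagram F ⥤ CatDiagram G where
  obj X := mapObj L X
  map {X Y} f :=
    { app := fun s => (L.app ⟨s⟩).toFunctor.map (Hom.app f s)
      naturality := fun {s t} a => by
        have h := (L.naturality a.toLoc).inv.toNatTrans.naturality (Hom.app f s)
        have e := congrArg (L.app ⟨t⟩).toFunctor.map (Hom.naturality f a)
        rw [Functor.map_comp, Functor.map_comp] at e
        dsimp at h
        dsimp only [mapObj]
        rw [Category.assoc, e, reassoc_of% h] }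
  map_id X := Hom.ext (funext fun s => (L.app ⟨s⟩).toFunctor.map_id _)
  map_comp f g := Hom.ext (funext fun s => (L.app ⟨s⟩).toFunctor.map_comp _ _)

end CatDiagram

end Diagrams

/-! ### Diagrams of model categories -/

/-- A diagram of model categories indexed by the small category `D`: a (pseudo)functor to `Cat`
all of whose values are complete and cocomplete model categories, and which sends every map of
`D` to a left Quillen functor. -/
structure ModelCatDiagram (D : Type w) [SmallCategory D] where
  toPseudofunctor : Pseudofunctor (LocallyDiscrete D) Cat.{v, u}
  modelCategory (s : D) : ModelCategory (toPseudofunctor.obj ⟨s⟩)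
  hasLimits (s : D) : HasLimitsOfSize.{w, w} (toPseudofunctor.obj ⟨s⟩)
  hasColimits (s : D) : HasColimitsOfSize.{w, w} (toPseudofunctor.obj ⟨s⟩)
  isLeftQuillen {s t : D} (a : s ⟶ t) : IsLeftQuillen (toPseudofunctor.map a.toLoc).toFunctor

namespace ModelCatDiagram

attribute [instance] modelCategory hasLimits hasColimits

variable {D : Type w} [SmallCategory D]

/-- The category of `M`-diagrams. -/
abbrev Diagram (M : ModelCatDiagram.{w, v, u} D) := CatDiagram M.toPseudofunctor

/-- A map of diagrams of model categories. -/
abbrev Hom (M N : ModelCatDiagram.{w, v, u} D) := 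
  Pseudofunctor.StrongTrans M.toPseudofunctor N.toPseudofunctor

/-- A model structure on the category of `M`-diagrams is the diagram-projective one if its weak
equivalences and its fibrations are defined objectwise. -/
structure IsDiagramProjective (M : ModelCatDiagram.{w, v, u} D) (P : ModelCategory M.Diagram) :
    Prop where
  weakEquivalence_iff : ∀ ⦃X Y : M.Diagram⦄ (f : X ⟶ Y),
    WeakEquivalence f ↔ ∀ s, WeakEquivalence (CatDiagram.Hom.app f s)
  fibration_iff : ∀ ⦃X Y : M.Diagram⦄ (f : X ⟶ Y),
    Fibration f ↔ ∀ s, Fibration (CatDiagram.Hom.app f s)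

/-- A model structure on the category of `M`-diagrams is the diagram-injective one if its weak
equivalences and its cofibrations are defined objectwise. -/
structure IsDiagramInjective (M : ModelCatDiagram.{w, v, u} D) (P : ModelCategory M.Diagram) :
    Prop where
  weakEquivalence_iff : ∀ ⦃X Y : M.Diagram⦄ (f : X ⟶ Y),
    WeakEquivalence f ↔ ∀ s, WeakEquivalence (CatDiagram.Hom.app f s)
  cofibration_iff : ∀ ⦃X Y : M.Diagram⦄ (f : X ⟶ Y),
    Cofibration f ↔ ∀ s, Cofibration (CatDiagram.Hom.app f s)

end ModelCatDiagram

/-! Everything is reduced to the individual objects of `D` through the evaluation functors.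
Evaluation at `s` has a left adjoint, the free diagram with value `∐ a_* x` over `a : s ⟶ t`, and a
right adjoint, the cofree diagram with value `∏ a^* y` over `a : t ⟶ s`, where `a^*` is right
adjoint to `a_*`. Limits and colimits of diagrams are objectwise, the latter because each `a_*`
preserves colimits.

Let `D` be direct. Its objects can be well-ordered so that a free diagram at `s` is initial at every
`t < s`, while its value at `s` is just `x`. To factor a map `X ⟶ Y` with objectwise right factor,
the values are corrected one at a time: attaching one free cell at the least bad place corrects it
without disturbing the earlier ones, and transfinite iteration corrects them all
(`hasFactorization_objectwise`). This gives both weak factorization systems. Since each `a^*`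
preserves fibrations, cofree diagrams on fibrations are objectwise fibrations. Hence maps with the
left lifting property against objectwise fibrations are objectwise trivial cofibrations, and the
retract argument completes the model structure (`exists_objectwise_projective`). The inverse case is
dual.

For the equivalence, the right adjoints of the functors `L(s)` assemble into a right adjoint on
diagrams (`mapAdj`), and transposition is objectwise. In either structure, cofibrant and fibrant
diagrams have cofibrant and fibrant values. The Quillen equivalence condition can therefore be
checked at each `s` separately. -/

namespace CategoryTheory.MorphismProperty

/-! ### Weak factorization systems with objectwise right class -/

section Objectwise

variable {E : Type u₁} [Category.{v₁} E] {I : Type w} {C : I → Type u₂}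
  [∀ s, Category.{v₂} (C s)] (ev : ∀ s, E ⥤ C s)

/-- The morphisms that are sent to `B s` by `ev s` for all `s`. -/
def objectwise (B : ∀ s, MorphismProperty (C s)) : MorphismProperty E :=
  fun _ _ f => ∀ s, B s ((ev s).map f)

instance objectwise_isStableUnderRetracts (B : ∀ s, MorphismProperty (C s))
    [∀ s, (B s).IsStableUnderRetracts] : (objectwise ev B).IsStableUnderRetracts where
  of_retract h hg s := of_retract (h.map (ev s)) (hg s)

variable {ev} in
/-- Free cells on `llp` morphisms have the left lifting property with respect to objectwise
morphisms. -/
lemma llp_objectwise_map {B : ∀ s, MorphismProperty (C s)} {s : I} {F : C s ⥤ E}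
    (adj : F ⊣ ev s) {x y : C s} (i : x ⟶ y) (hi : (B s).llp i) :
    (objectwise ev B).llp (F.map i) := fun _ _ p hp =>
  (adj.hasLiftingProperty_iff i p).2 (hi _ (hp s))

variable {ev}

/-- Given `Z ⟶ Y` and a factorization of its value at `s`, attaching a free cell at `s` makes
the value at `s` the second map of this factorization. -/
lemma exists_cell_extension [HasPushouts E] (B : ∀ s, MorphismProperty (C s))
    [∀ s, (B s).RespectsIso] {s : I} {F : C s ⥤ E} (adj : F ⊣ ev s)
    (hunit : ∀ x, IsIso (adj.unit.app x)) [∀ t, PreservesColimitsOfShape WalkingSpan (ev t)]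
    {Y : E} (Z : Over Y) (hfac : HasFactorization (B s).llp (B s)) :
    ∃ (Z' : Over Y) (φ : Z ⟶ Z'), (objectwise ev B).llp φ.left ∧ B s ((ev s).map Z'.hom) ∧
      ∀ t, (∀ ⦃x y : C s⦄ (i : x ⟶ y), IsIso ((ev t).map (F.map i))) →
        IsIso ((ev t).map φ.left) := by
  let d := factorizationData (B s).llp (B s) ((ev s).map Z.hom)
  let q : F.obj d.Z ⟶ Y := (adj.homEquiv _ _).symm d.p
  have hq : F.map d.i ≫ q = adj.counit.app Z.left ≫ Z.hom := by
    apply (adj.homEquiv _ _).injective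
    simp [q, Adjunction.homEquiv_unit, Adjunction.homEquiv_counit]
  -- The cell `F.map d.i` is attached to `Z` along the counit, and the adjunct `q` of `d.p` extends
  -- the map to `Y`.
  have sq := IsPushout.of_hasPushout (adj.counit.app Z.left) (F.map d.i)
  let Z' : Over Y := CategoryTheory.Over.mk (sq.desc Z.hom q hq.symm)
  refine ⟨Z', CategoryTheory.Over.homMk (pushout.inl _ _) (by simp [Z']), ?_, ?_, ?_⟩
  · exact of_isPushout sq (llp_objectwise_map adj _ d.hi)
  · have sq' := sq.map (ev s)
    -- By the triangle identity, an invertible unit makes `ev s` of the counit invertible. So at `s`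
    -- the pushout is `d.Z`, up to the unit, and its map to `Y` is `d.p`.
    have h1 : IsIso ((ev s).map (adj.counit.app Z.left)) := by
      have := hunit ((ev s).obj Z.left)
      exact IsIso.of_isIso_fac_left (adj.right_triangle_components Z.left)
    have h2 : IsIso ((ev s).map (pushout.inr (adj.counit.app Z.left) (F.map d.i))) :=
      sq'.isIso_inr_of_isIso
    have h3 : (adj.unit.app d.Z ≫
        (ev s).map (pushout.inr (adj.counit.app Z.left) (F.map d.i))) ≫ (ev s).map Z'.hom
          = d.p := by
      rw [Category.assoc, ← Functor.map_comp]
      simp only [Z', CategoryTheory.Over.mk_hom, IsPushout.inr_desc, q]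
      erw [← Adjunction.homEquiv_unit]
      simp
    have := hunit d.Z
    exact ((B s).cancel_left_of_respectsIso (adj.unit.app d.Z ≫
        (ev s).map (pushout.inr (adj.counit.app Z.left) (F.map d.i))) _).1 (by rw [h3]; exact d.hp)
  · intro t ht
    have sq' := sq.map (ev t)
    have := ht d.i
    exact sq'.isIso_inl_of_isIso

/-- The value of `Z ⟶ Y` at `s` belongs to `B s`. -/
abbrev GoodAt (ev : ∀ s, E ⥤ C s) (B : ∀ s, MorphismProperty (C s)) {Y : E} (Z : Over Y) (s : I) :
    Prop :=
  B s ((ev s).map Z.hom)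

lemma GoodAt.of_isIso {B : ∀ s, MorphismProperty (C s)} [∀ s, (B s).RespectsIso] {Y : E}
    {Z Z' : Over Y} (φ : Z ⟶ Z') {s : I} [IsIso ((ev s).map φ.left)] (h : GoodAt ev B Z s) :
    GoodAt ev B Z' s := by
  rw [GoodAt, ← CategoryTheory.Over.w φ, Functor.map_comp] at h
  exact ((B s).cancel_left_of_respectsIso _ _).1 h

/-- Improve `Z ⟶ Y` at the least place where it is not good. -/
lemma exists_improvement [HasPushouts E] [LinearOrder I] [WellFoundedLT I]
    (B : ∀ s, MorphismProperty (C s)) [∀ s, (B s).RespectsIso]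
    (hfac : ∀ s, HasFactorization (B s).llp (B s)) {F : ∀ s, C s ⥤ E} (adj : ∀ s, F s ⊣ ev s)
    (hunit : ∀ s x, IsIso ((adj s).unit.app x))
    (hlt : ∀ ⦃s t⦄, t < s → ∀ ⦃x y : C s⦄ (i : x ⟶ y), IsIso ((ev t).map ((F s).map i)))
    [∀ t, PreservesColimitsOfShape WalkingSpan (ev t)] {Y : E} (Z : Over Y) :
    ∃ (Z' : Over Y) (φ : Z ⟶ Z'), (objectwise ev B).llp φ.left ∧
      (∀ s, (∀ t < s, GoodAt ev B Z t) → GoodAt ev B Z' s) ∧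
      (∀ s, (∀ t ≤ s, GoodAt ev B Z t) → IsIso ((ev s).map φ.left)) := by
  by_cases h : ∃ s, ¬ GoodAt ev B Z s
  -- A place all of whose predecessors are good lies at or below the least bad place `s`. The cell
  -- at `s` leaves the places below `s` unchanged and corrects `s` itself.
  · obtain ⟨s, hs, hmin⟩ := WellFounded.has_min wellFounded_lt {s | ¬ GoodAt ev B Z s} h
    obtain ⟨Z', φ, h₁, h₂, h₃⟩ := exists_cell_extension B (adj s) (hunit s) Z (hfac s)
    have hiso (t) (ht : ∀ t' ≤ t, GoodAt ev B Z t') : IsIso ((ev t).map φ.left) :=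
      h₃ t (hlt (not_le.1 fun hst => hs (ht s hst)))
    refine ⟨Z', φ, h₁, fun t ht => ?_, hiso⟩
    rcases lt_trichotomy t s with hts | rfl | hst
    · have := h₃ t (hlt hts)
      exact GoodAt.of_isIso φ (not_not.1 fun h => hmin t h hts)
    · exact h₂
    · exact (hs (ht s hst)).elim
  · push Not at h
    exact ⟨Z, 𝟙 Z, id_mem _ _, fun s _ => h s, fun s _ => by
      rw [CategoryTheory.Over.id_left, Functor.map_id]; infer_instance⟩

/-- After evaluation at `s` the diagram is constant from `j` on, so stage `j` already computes its
colimit. -/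
lemma goodAt_of_isColimit {B : ∀ s, MorphismProperty (C s)} [∀ s, (B s).RespectsIso] {Y : E}
    {J : Type w} [SmallCategory J] [IsFiltered J] [HasColimitsOfSize.{w, w} E]
    {K : J ⥤ Over Y} {c : Cocone K} (hc : IsColimit c) {s : I}
    [PreservesColimitsOfSize.{w, w} (ev s)] {j : J}
    (hconst : ∀ ⦃j' : J⦄ (a : j ⟶ j'), IsIso ((ev s).map (K.map a).left))
    (h : GoodAt ev B (K.obj j) s) :
    IsIso ((ev s).map (c.ι.app j).left) ∧ GoodAt ev B c.pt s := by
  have hK : (K ⋙ CategoryTheory.Over.forget Y ⋙ ev s).IsEventuallyConstantFrom j := hconst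
  have : IsIso ((ev s).map (c.ι.app j).left) :=
    hK.isIso_ι_of_isColimit (isColimitOfPreserves (CategoryTheory.Over.forget Y ⋙ ev s) hc)
  exact ⟨this, GoodAt.of_isIso (c.ι.app j) h⟩

section Iteration

variable {B : ∀ s, MorphismProperty (C s)} [∀ s, (B s).RespectsIso] {Y : E}
  {J : Type w} [LinearOrder J] [SuccOrder J] [WellFoundedLT J]
  [HasColimitsOfSize.{w, w} E] [∀ s, PreservesColimitsOfSize.{w, w} (ev s)] [LinearOrder I]

/-- Stage `f s` has all places below `s` good, so the next step makes `s` good; from then on the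
value at `s` never changes. Goodness and stability are proved together, because passing a limit
stage requires both. -/
lemma goodAt_iteration (K : J ⥤ Over Y) [K.IsWellOrderContinuous] (f : I → J) (hf : StrictMono f)
    (h₁ : ∀ j, ¬ IsMax j → ∀ s, (∀ t < s, GoodAt ev B (K.obj j) t) →
      GoodAt ev B (K.obj (Order.succ j)) s)
    (h₂ : ∀ j, ¬ IsMax j → ∀ s, (∀ t ≤ s, GoodAt ev B (K.obj j) t) →
      IsIso ((ev s).map (K.map (homOfLE (Order.le_succ j))).left)) (j : J) :
    ∀ s, f s < j → GoodAt ev B (K.obj j) s ∧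
      ∀ (i : J) (hij : i ≤ j), f s < i → IsIso ((ev s).map (K.map (homOfLE hij)).left) := by
  induction j using SuccOrder.limitRecOn with
  | isMin j hj => exact fun s hs => (hj.not_lt hs).elim
  | succ j hj ih =>
    intro s hs
    have hs' := Order.le_of_lt_succ hs
    refine ⟨h₁ j hj s fun t ht => (ih t ((hf ht).trans_le hs')).1, fun i hij hi => ?_⟩
    rcases hij.eq_or_lt with rfl | hij'
    · rw [show homOfLE hij = 𝟙 _ from rfl, K.map_id, CategoryTheory.Over.id_left, Functor.map_id]
      infer_instance
    · have hij' := Order.le_of_lt_succ hij'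
      have := (ih s (hi.trans_le hij')).2 i hij' hi
      have := h₂ j hj s fun t ht =>
        (ih t (((hf.monotone ht).trans_lt hi).trans_le hij')).1
      rw [← homOfLE_comp hij' (Order.le_succ j), K.map_comp, CategoryTheory.Over.comp_left,
        Functor.map_comp]
      infer_instance
  | isSuccLimit j hj ih =>
    intro s hs
    have : Nonempty (Set.Iio j) := ⟨⟨f s, hs⟩⟩
    have key (i : J) (hij : i < j) (hi : f s < i) :=
      goodAt_of_isColimit (ev := ev) (B := B) (s := s) (K.isColimitOfIsWellOrderContinuous j hj)
        (j := ⟨i, hij⟩)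
        (fun j' a => (ih j' j'.2 s (hi.trans_le (leOfHom a))).2 i (leOfHom a) hi) (ih i hij s hi).1
    -- The first stage at which `s` is known to be good is the successor of `f s`, which is still
    -- below the limit `j`.
    refine ⟨(key _ (hj.succ_lt hs) (Order.lt_succ_of_not_isMax hs.not_isMax)).2,
      fun i hij hi => ?_⟩
    rcases hij.eq_or_lt with rfl | hij'
    · rw [show homOfLE hij = 𝟙 _ from rfl, K.map_id, CategoryTheory.Over.id_left, Functor.map_id]
      infer_instance
    · exact (key i hij' hi).1

end Iteration

section WFS

variable [LinearOrder I] [WellFoundedLT I] [HasColimitsOfSize.{w, w} E]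
  [∀ s, PreservesColimitsOfSize.{w, w} (ev s)]

/-- The left factor is a transfinite composition of attached free cells, hence has the lifting
property. The right factor is good everywhere once the iteration has passed every place. -/
lemma hasFactorization_objectwise
    (B : ∀ s, MorphismProperty (C s)) [∀ s, (B s).RespectsIso]
    (hfac : ∀ s, HasFactorization (B s).llp (B s)) {F : ∀ s, C s ⥤ E} (adj : ∀ s, F s ⊣ ev s)
    (hunit : ∀ s x, IsIso ((adj s).unit.app x))
    (hlt : ∀ ⦃s t⦄, t < s → ∀ ⦃x y : C s⦄ (i : x ⟶ y), IsIso ((ev t).map ((F s).map i))) :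
    HasFactorization (objectwise ev B).llp (objectwise ev B) where
  nonempty_mapFactorizationData {X Y} f := by
    have : HasPushouts E := by
      have := hasFiniteColimits_of_hasColimitsOfSize.{w, w} E
      infer_instance
    have (t : I) : PreservesColimitsOfShape WalkingSpan (ev t) := by
      have := PreservesColimitsOfSize.preservesFiniteColimits (ev t)
      infer_instance
    choose succ toSucc h₁ h₂ h₃ using
      exists_improvement (ev := ev) B hfac adj hunit hlt (Y := Y)
    let Φ : SmallObject.SuccStruct (Over Y) :=
      { X₀ := CategoryTheory.Over.mk f, succ := succ, toSucc := toSucc }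
    have (K : Type w) [SmallCategory K] : HasColimitsOfShape K (Over Y) :=
      inferInstanceAs (HasColimitsOfShape K (CategoryTheory.Over Y))
    -- The extra stage `⊤` lies strictly above the stage of every `s`, so all places are good there.
    let J := WithTop I
    let : OrderBot J := WellFoundedLT.toOrderBot J
    let : SuccOrder J := SuccOrder.ofLinearWellFoundedLT J
    have : HasIterationOfShape J (Over Y) := { }
    have hiso {Z Z' : Over Y} (e : Z ≅ Z') (s : I) : IsIso ((ev s).map e.hom.left) :=
      inferInstanceAs (IsIso ((CategoryTheory.Over.forget Y ⋙ ev s).map e.hom))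
    have hgood := goodAt_iteration (ev := ev) (B := B) (Φ.iterationFunctor J)
      (fun s => (s : WithTop I)) (fun _ _ h => WithTop.coe_lt_coe.2 h)
      (fun j hj s hs => by
        have : IsIso ((ev s).map (Φ.iterationFunctorObjSuccIso j hj).inv.left) :=
          hiso (Φ.iterationFunctorObjSuccIso j hj).symm s
        exact GoodAt.of_isIso (Φ.iterationFunctorObjSuccIso j hj).inv (h₂ _ s hs))
      (fun j hj s hs => by
        have : IsIso ((ev s).map (Φ.iterationFunctorObjSuccIso j hj).inv.left) :=
          hiso (Φ.iterationFunctorObjSuccIso j hj).symm s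
        rw [Φ.iterationFunctor_map_succ j hj, CategoryTheory.Over.comp_left, Functor.map_comp]
        exact IsIso.comp_isIso' (h₃ _ s hs) this)
    have hZ (s : I) : GoodAt ev B (Φ.iteration J) s := by
      obtain ⟨h, -⟩ := hgood ⊤ s (WithTop.coe_lt_top s)
      -- The colimit runs over all of `J`, whose largest stage is `⊤`: no further change can occur
      -- after it.
      refine (goodAt_of_isColimit (Φ.isColimitIterationCocone J) (j := (⊤ : WithTop I))
        (fun j' a => ?_) h).2
      obtain rfl : j' = (⊤ : WithTop I) := top_le_iff.1 (leOfHom a)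
      rw [show a = 𝟙 _ from rfl, Functor.map_id, CategoryTheory.Over.id_left, Functor.map_id]
      infer_instance
    have hι : (objectwise ev B).llp (Φ.ιIteration J).left := by
      have hΦ : Φ.prop ≤ (objectwise ev B).llp.inverseImage (CategoryTheory.Over.forget Y) := by
        rintro _ _ _ ⟨⟩
        exact h₁ _
      have : PreservesWellOrderContinuousOfShape J (CategoryTheory.Over.forget Y) := { }
      exact transfiniteCompositionsOfShape_le _ _ _
        ((Φ.transfiniteCompositionOfShapeιIteration J).ofLE hΦ).map.mem
    exact ⟨{
      Z := (Φ.iteration J).left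
      i := (Φ.ιIteration J).left
      p := (Φ.iteration J).hom
      fac := CategoryTheory.Over.w (Φ.ιIteration J)
      hi := hι
      hp := hZ }⟩

/-- Weak factorization systems on the values of a category with evaluation functors
induce one whose right class is defined objectwise, if the evaluation functors have "triangular"
left adjoints. -/
lemma isWeakFactorizationSystem_objectwise
    (A B : ∀ s, MorphismProperty (C s)) [∀ s, IsWeakFactorizationSystem (A s) (B s)]
    {F : ∀ s, C s ⥤ E} (adj : ∀ s, F s ⊣ ev s) (hunit : ∀ s x, IsIso ((adj s).unit.app x))
    (hlt : ∀ ⦃s t⦄, t < s → ∀ ⦃x y : C s⦄ (i : x ⟶ y), IsIso ((ev t).map ((F s).map i))) :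
    IsWeakFactorizationSystem (objectwise ev B).llp (objectwise ev B) := by
  have hB (s : I) : (B s).llp = A s := llp_eq_of_wfs _ _
  have (s : I) : (B s).IsStableUnderRetracts := by
    rw [← rlp_eq_of_wfs (A s) (B s)]; infer_instance
  have := hasFactorization_objectwise B (fun s => by rw [hB]; infer_instance) adj hunit hlt
  exact .mk' _ _ fun i p hi hp => hi p hp

end WFS

end Objectwise

end CategoryTheory.MorphismProperty

/-! ### Objectwise projective and injective model structures -/

namespace HomotopicalAlgebra

open MorphismProperty

section Objectwise

variable {E : Type u₁} [Category.{v₁} E] {I : Type w} {C : I → Type u₂}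
  [∀ s, Category.{v₂} (C s)] [∀ s, ModelCategory (C s)] {ev : ∀ s, E ⥤ C s}

-- By adjunction, lifting `(ev s).map i` against `p` amounts to lifting `i` against `(G s).map p`,
-- which is objectwise in `B` by `hG`.
omit [∀ s, ModelCategory (C s)] in
lemma llp_objectwise_le {A B : ∀ s, MorphismProperty (C s)}
    [∀ s, IsWeakFactorizationSystem (A s) (B s)] {G : ∀ s, C s ⥤ E} (adj : ∀ s, ev s ⊣ G s)
    (hG : ∀ s t ⦃x y : C s⦄ (p : x ⟶ y), B s p → B t ((ev t).map ((G s).map p))) :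
    (objectwise ev B).llp ≤ objectwise ev A := fun _ _ i hi s => by
  rw [← llp_eq_of_wfs (A s) (B s)]
  intro _ _ p hp
  exact ((adj s).hasLiftingProperty_iff i p).2 (hi _ fun t => hG s t p hp)

/-- The objectwise projective model structure on a category with evaluation functors. -/
theorem exists_objectwise_projective [HasColimitsOfSize.{w, w} E] [HasFiniteLimits E]
    {F : ∀ s, C s ⥤ E} (adjF : ∀ s, F s ⊣ ev s) {G : ∀ s, C s ⥤ E} (adjG : ∀ s, ev s ⊣ G s)
    {r : I → I → Prop} (hr : WellFounded r) (hunit : ∀ s x, IsIso ((adjF s).unit.app x))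
    (hF : ∀ ⦃s t⦄, s ≠ t → ¬ r s t → ∀ ⦃x y : C s⦄ (i : x ⟶ y), IsIso ((ev t).map ((F s).map i)))
    (hG : ∀ s t ⦃x y : C s⦄ (p : x ⟶ y), fibrations (C s) p →
      fibrations (C t) ((ev t).map ((G s).map p))) :
    ∃ _ : ModelCategory E,
      weakEquivalences E = objectwise ev (fun s => weakEquivalences (C s)) ∧
      fibrations E = objectwise ev (fun s => fibrations (C s)) := by
  have : IsWellFounded I r := ⟨hr⟩
  -- Refining `r` to a well-order turns `t < s` into the failure of `r s t`, which is what `hF`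
  -- requires.
  obtain ⟨lt, hlt, _⟩ := IsWellFounded.exists_well_order_ge r
  classical
  let _ : LinearOrder I := linearOrderOfSTO lt
  have : WellFoundedLT I := ⟨(inferInstance : IsWellFounded I lt).wf⟩
  have hF' ⦃s t : I⦄ (h : t < s) ⦃x y : C s⦄ (i : x ⟶ y) : IsIso ((ev t).map ((F s).map i)) :=
    hF h.ne' (fun hst => lt_asymm h (hlt s t hst)) i
  have (s : I) : PreservesColimitsOfSize.{w, w} (ev s) := (adjG s).leftAdjoint_preservesColimits
  have : HasFiniteColimits E := hasFiniteColimits_of_hasColimitsOfSize.{w, w} E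
  have wfs₁ := isWeakFactorizationSystem_objectwise (fun s => cofibrations (C s))
    (fun s => trivialFibrations (C s)) adjF hunit hF'
  have wfs₂ := isWeakFactorizationSystem_objectwise (fun s => trivialCofibrations (C s))
    (fun s => fibrations (C s)) adjF hunit hF'
  let _ : CategoryWithFibrations E := ⟨objectwise ev (fun s => fibrations (C s))⟩
  let _ : CategoryWithWeakEquivalences E := ⟨objectwise ev (fun s => weakEquivalences (C s))⟩
  let _ : CategoryWithCofibrations E :=
    ⟨(objectwise ev (fun s => trivialFibrations (C s))).llp⟩
  have : (weakEquivalences E).HasTwoOutOfThreeProperty :=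
    { comp_mem f g hf hg s := by
        rw [Functor.map_comp]; exact comp_mem _ _ _ (hf s) (hg s)
      of_postcomp f g hg hfg s := by
        have := hfg s
        rw [Functor.map_comp] at this
        exact of_postcomp _ _ _ (hg s) this
      of_precomp f g hf hfg s := by
        have := hfg s
        rw [Functor.map_comp] at this
        exact of_precomp _ _ _ (hf s) this }
  have e₁ : trivialFibrations E = objectwise ev (fun s => trivialFibrations (C s)) := by
    ext X Y f
    exact ⟨fun h s => ⟨h.1 s, h.2 s⟩, fun h => ⟨fun s => (h s).1, fun s => (h s).2⟩⟩
  have e₂ : trivialCofibrations E = (objectwise ev (fun s => fibrations (C s))).llp := by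
    apply le_antisymm
    · rintro X Y f ⟨hf, hf'⟩
      -- Retract argument: `d.i` is an objectwise trivial cofibration, so two-out-of-three makes
      -- `d.p` a trivial fibration. Then `f` lifts against `d.p` and is a retract of `d.i`.
      let d := factorizationData (objectwise ev (fun s => fibrations (C s))).llp
        (objectwise ev (fun s => fibrations (C s))) f
      have hi : weakEquivalences E d.i := fun s =>
        (llp_objectwise_le (A := fun s => trivialCofibrations (C s)) adjG hG _ d.hi s).2
      have hp : weakEquivalences E d.p :=
        of_precomp _ _ _ hi (by rw [d.fac]; exact hf')
      have := hf d.p fun s => ⟨d.hp s, hp s⟩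
      exact of_retract (RetractArrow.ofLeftLiftingProperty d.fac) d.hi
    · intro X Y f hf
      exact ⟨antitone_llp (fun _ _ _ h s => (h s).1) _ hf, fun s =>
        (llp_objectwise_le (A := fun s => trivialCofibrations (C s)) adjG hG _ hf s).2⟩
  have : IsWeakFactorizationSystem (cofibrations E) (trivialFibrations E) := by
    rw [e₁]; exact wfs₁
  have : IsWeakFactorizationSystem (trivialCofibrations E) (fibrations E) := by
    rw [e₂]; exact wfs₂
  exact ⟨ModelCategory.mk' E, rfl, rfl⟩

/-- The objectwise injective model structure on a category with evaluation functors. -/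
theorem exists_objectwise_injective [HasLimitsOfSize.{w, w} E] [HasFiniteColimits E]
    {F : ∀ s, C s ⥤ E} (adjF : ∀ s, F s ⊣ ev s) {G : ∀ s, C s ⥤ E} (adjG : ∀ s, ev s ⊣ G s)
    {r : I → I → Prop} (hr : WellFounded r) (hcounit : ∀ s x, IsIso ((adjG s).counit.app x))
    (hG : ∀ ⦃s t⦄, s ≠ t → ¬ r s t → ∀ ⦃x y : C s⦄ (p : x ⟶ y), IsIso ((ev t).map ((G s).map p)))
    (hF : ∀ s t ⦃x y : C s⦄ (i : x ⟶ y), cofibrations (C s) i →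
      cofibrations (C t) ((ev t).map ((F s).map i))) :
    ∃ _ : ModelCategory E,
      weakEquivalences E = objectwise ev (fun s => weakEquivalences (C s)) ∧
      cofibrations E = objectwise ev (fun s => cofibrations (C s)) := by
  -- In the opposite categories the two adjoints of evaluation exchange roles, and cofibrations
  -- become fibrations.
  obtain ⟨P, hP, hP'⟩ := exists_objectwise_projective (E := Eᵒᵖ) (C := fun s => (C s)ᵒᵖ)
    (ev := fun s => (ev s).op) (fun s => (adjG s).op) (fun s => (adjF s).op) hr
    (fun s x => by
      have := hcounit s x.unop
      exact inferInstanceAs (IsIso ((adjG s).counit.app x.unop).op))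
    (fun s t hst hr x y i => by
      have := hG hst hr i.unop
      exact inferInstanceAs (IsIso ((ev t).map ((G s).map i.unop)).op))
    (fun s t x y p hp => hF s t p.unop hp)
  have hW := congrArg MorphismProperty.unop hP
  have hCof := congrArg MorphismProperty.unop hP'
  let _ : CategoryWithFibrations E := ⟨(cofibrations Eᵒᵖ).unop⟩
  let _ : CategoryWithCofibrations E := ⟨(fibrations Eᵒᵖ).unop⟩
  let _ : CategoryWithWeakEquivalences E := ⟨(weakEquivalences Eᵒᵖ).unop⟩
  -- The structure on `Eᵒᵖ` gives one on `Eᵒᵖᵒᵖ`, which is carried back to `E`.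
  exact ⟨ModelCategory.transport (opOpEquivalence E).symm rfl rfl rfl, hW, hCof⟩

end Objectwise

/-! ### Quillen adjunctions seen from the right adjoint -/

section Quillen

variable {C : Type u₁} [Category.{v₁} C] [ModelCategory C]
  {D : Type u₂} [Category.{v₂} D] [ModelCategory D] {F : C ⥤ D} {G : D ⥤ C} {adj : F ⊣ G}

lemma _root_.IsQuillenAdjunction.map_fibration (h : IsQuillenAdjunction adj) {X Y : D} (p : X ⟶ Y)
    (hp : fibrations D p) : fibrations C (G.map p) := by
  rw [← rlp_eq_of_wfs (trivialCofibrations C) (fibrations C)]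
  exact fun _ _ i hi => (adj.hasLiftingProperty_iff i p).1
    (hasLiftingProperty_of_wfs _ _ (h.map_trivialCofibration i hi) hp)

lemma _root_.IsQuillenAdjunction.map_trivialFibration (h : IsQuillenAdjunction adj) {X Y : D}
    (p : X ⟶ Y) (hp : trivialFibrations D p) : trivialFibrations C (G.map p) := by
  rw [← rlp_eq_of_wfs (cofibrations C) (trivialFibrations C)]
  exact fun _ _ i hi => (adj.hasLiftingProperty_iff i p).1
    (hasLiftingProperty_of_wfs _ _ (h.map_cofibration i hi) hp)

lemma _root_.IsQuillenAdjunction.of_right_adjoint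
    (h : ∀ ⦃X Y : D⦄ (p : X ⟶ Y), fibrations D p → fibrations C (G.map p))
    (h' : ∀ ⦃X Y : D⦄ (p : X ⟶ Y), trivialFibrations D p → trivialFibrations C (G.map p)) :
    IsQuillenAdjunction adj where
  map_cofibration X Y i hi := by
    rw [← llp_eq_of_wfs (cofibrations D) (trivialFibrations D)]
    exact fun _ _ p hp => (adj.hasLiftingProperty_iff i p).2
      (hasLiftingProperty_of_wfs _ _ hi (h' p hp))
  map_trivialCofibration X Y i hi := by
    rw [← llp_eq_of_wfs (trivialCofibrations D) (fibrations D)]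
    exact fun _ _ p hp => (adj.hasLiftingProperty_iff i p).2
      (hasLiftingProperty_of_wfs _ _ hi (h p hp))

/-- The defining conditions involve only the left adjoint, so any choice of right adjoint will do.
-/
lemma _root_.IsLeftQuillen.isQuillenAdjunction (hF : IsLeftQuillen F) (adj : F ⊣ G) :
    IsQuillenAdjunction adj := by
  obtain ⟨_, _, h⟩ := hF
  exact ⟨h.map_cofibration, h.map_trivialCofibration⟩

lemma isCofibrant_obj_of_isLeftAdjoint [F.IsLeftAdjoint]
    (hF : ∀ ⦃X Y : C⦄ (f : X ⟶ Y), cofibrations C f → cofibrations D (F.map f)) (X : C)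
    [hX : IsCofibrant X] : IsCofibrant (F.obj X) := by
  rw [isCofibrant_iff_of_isInitial (F.map (initial.to X)) (initialIsInitial.isInitialObj F _),
    cofibration_iff]
  exact hF _ ((cofibration_iff _).1 hX)

lemma isFibrant_obj_of_isRightAdjoint [F.IsRightAdjoint]
    (hF : ∀ ⦃X Y : C⦄ (f : X ⟶ Y), fibrations C f → fibrations D (F.map f)) (X : C)
    [hX : IsFibrant X] : IsFibrant (F.obj X) := by
  rw [isFibrant_iff_of_isTerminal (F.map (terminal.from X))
    (terminalIsTerminal.isTerminalObj F _), fibration_iff]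
  exact hF _ ((fibration_iff _).1 hX)

end Quillen

end HomotopicalAlgebra

/-! ### Diagrams as sections of the Grothendieck construction -/

namespace CatDiagram

variable {D : Type w} [SmallCategory D] (F : Pseudofunctor (LocallyDiscrete D) Cat.{v, u})

/-- The functor `a_*`. -/
abbrev push {s t : D} (a : s ⟶ t) : F.obj ⟨s⟩ ⥤ F.obj ⟨t⟩ := (F.map a.toLoc).toFunctor

variable {F}

/-- An object of a fiber, as an object of the Grothendieck construction. -/
abbrev tot {s : D} (x : F.obj ⟨s⟩) : F.Grothendieck := ⟨s, x⟩

/-- A map `a_* x ⟶ y`, as a map `x ⟶ y` over `a` in the Grothendieck construction. -/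
def ov {s t : D} (a : s ⟶ t) {x : F.obj ⟨s⟩} {y : F.obj ⟨t⟩} (g : (push F a).obj x ⟶ y) :
    tot x ⟶ tot y :=
  ⟨a, g⟩

lemma ov_injective {s t : D} {a : s ⟶ t} {x : F.obj ⟨s⟩} {y : F.obj ⟨t⟩}
    {g g' : (push F a).obj x ⟶ y} (h : ov a g = ov a g') : g = g' := by
  injection h

/-- The isomorphism `𝟙_* x ≅ x`. -/
def idHom {s : D} (x : F.obj ⟨s⟩) : (push F (𝟙 s)).obj x ⟶ x :=
  (F.mapId ⟨s⟩).hom.toNatTrans.app x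

instance {s : D} (x : F.obj ⟨s⟩) : IsIso (idHom x) :=
  inferInstanceAs (IsIso ((F.mapId ⟨s⟩).hom.toNatTrans.app x))

lemma idHom_naturality {s : D} {x y : F.obj ⟨s⟩} (f : x ⟶ y) :
    (push F (𝟙 s)).map f ≫ idHom y = idHom x ≫ f :=
  (F.mapId ⟨s⟩).hom.toNatTrans.naturality f

/-- The isomorphism `(a ≫ b)_* x ≅ b_* a_* x`. -/
def compHom {r s t : D} (a : r ⟶ s) (b : s ⟶ t) (x : F.obj ⟨r⟩) :
    (push F (a ≫ b)).obj x ⟶ (push F b).obj ((push F a).obj x) :=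
  (F.mapComp a.toLoc b.toLoc).hom.toNatTrans.app x

instance {r s t : D} (a : r ⟶ s) (b : s ⟶ t) (x : F.obj ⟨r⟩) : IsIso (compHom a b x) :=
  inferInstanceAs (IsIso ((F.mapComp a.toLoc b.toLoc).hom.toNatTrans.app x))

/-- A map in a fiber, as a map in the Grothendieck construction. -/
def vert {s : D} {x y : F.obj ⟨s⟩} (f : x ⟶ y) : tot x ⟶ tot y :=
  ov (𝟙 s) (idHom x ≫ f)

lemma ov_idHom {s : D} (x : F.obj ⟨s⟩) : ov (𝟙 s) (idHom x) = 𝟙 (tot x) := rfl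

@[simp]
lemma vert_id {s : D} (x : F.obj ⟨s⟩) : vert (𝟙 x) = 𝟙 (tot x) := by
  rw [vert, Category.comp_id, ov_idHom]

/-- Composition in the Grothendieck construction absorbs the coherence isomorphisms of `F`.
Identities between structure maps can then be proved with plain associativity and unit laws, and
brought back by `ov_injective`. -/
lemma ov_comp_ov {r s t : D} (a : r ⟶ s) (b : s ⟶ t) {x : F.obj ⟨r⟩} {y : F.obj ⟨s⟩}
    {z : F.obj ⟨t⟩} (f : (push F a).obj x ⟶ y) (g : (push F b).obj y ⟶ z) :
    ov a f ≫ ov b g = ov (a ≫ b) (compHom a b x ≫ (push F b).map f ≫ g) := rfl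

lemma ov_comp_vert {s t : D} (a : s ⟶ t) {x : F.obj ⟨s⟩} {y z : F.obj ⟨t⟩}
    (g : (push F a).obj x ⟶ y) (f : y ⟶ z) : ov a g ≫ vert f = ov a (g ≫ f) := by
  rw [← Category.comp_id (ov a (g ≫ f)), ← ov_idHom, vert, ov_comp_ov, ov_comp_ov,
    Functor.map_comp, Category.assoc, idHom_naturality]

lemma vert_comp_ov {s t : D} (a : s ⟶ t) {x y : F.obj ⟨s⟩} {z : F.obj ⟨t⟩}
    (f : x ⟶ y) (g : (push F a).obj y ⟶ z) : vert f ≫ ov a g = ov a ((push F a).map f ≫ g) := by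
  rw [← Category.id_comp (ov a ((push F a).map f ≫ g)), ← ov_idHom, vert, ov_comp_ov, ov_comp_ov,
    Functor.map_comp, Category.assoc]

lemma vert_comp {s : D} {x y z : F.obj ⟨s⟩} (f : x ⟶ y) (g : y ⟶ z) :
    vert (f ≫ g) = vert f ≫ vert g := by
  conv_rhs => rw [vert, ov_comp_vert]
  rw [vert, Category.assoc]

lemma vert_injective {s : D} {x y : F.obj ⟨s⟩} {f g : x ⟶ y} (h : vert f = vert g) : f = g := by
  have := ov_injective h
  exact (cancel_epi (idHom x)).1 this

/-- The structure maps of a diagram, in the Grothendieck construction. -/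
def sec (X : CatDiagram F) {s t : D} (a : s ⟶ t) : tot (X.obj s) ⟶ tot (X.obj t) := ov a (X.map a)

lemma sec_id (X : CatDiagram F) (s : D) : X.sec (𝟙 s) = 𝟙 _ := by
  rw [sec, X.map_id]; rfl

lemma sec_comp (X : CatDiagram F) {r s t : D} (a : r ⟶ s) (b : s ⟶ t) :
    X.sec (a ≫ b) = X.sec a ≫ X.sec b := by
  rw [sec, X.map_comp]; rfl

/-- Construct a diagram from a family of maps in the Grothendieck construction. -/
abbrev ofSec (obj : ∀ s : D, F.obj ⟨s⟩)
    (map : ∀ {s t : D} (a : s ⟶ t), (push F a).obj (obj s) ⟶ obj t)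
    (map_id : ∀ s, ov (𝟙 s) (map (𝟙 s)) = 𝟙 _)
    (map_comp : ∀ {r s t : D} (a : r ⟶ s) (b : s ⟶ t),
      ov (a ≫ b) (map (a ≫ b)) = ov a (map a) ≫ ov b (map b)) : CatDiagram F where
  obj := obj
  map := map
  map_id s := ov_injective (map_id s)
  map_comp a b := ov_injective (map_comp a b)

lemma Hom.sec_comp_vert {X Y : CatDiagram F} (f : Hom X Y) {s t : D} (a : s ⟶ t) :
    X.sec a ≫ vert (f.app t) = vert (f.app s) ≫ Y.sec a := by
  rw [sec, sec, ov_comp_vert, vert_comp_ov, f.naturality]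

/-- Construct a map of diagrams from a naturality property in the Grothendieck construction. -/
def Hom.ofVert {X Y : CatDiagram F} (app : ∀ s, X.obj s ⟶ Y.obj s)
    (h : ∀ {s t : D} (a : s ⟶ t), X.sec a ≫ vert (app t) = vert (app s) ≫ Y.sec a) : Hom X Y where
  app := app
  naturality a := by
    have := h a
    rw [sec, sec, ov_comp_vert, vert_comp_ov] at this
    exact ov_injective this

end CatDiagram

/-! ### Evaluation, and objectwise limits and colimits -/

namespace CatDiagram

variable {D : Type w} [SmallCategory D] {F : Pseudofunctor (LocallyDiscrete D) Cat.{v, u}}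

variable (F) in
/-- The evaluation functor at `s`. -/
@[simps]
def eval (s : D) : CatDiagram F ⥤ F.obj ⟨s⟩ where
  obj X := X.obj s
  map f := Hom.app f s

section JointlyMono

variable {ι : Type*} (X : ι → CatDiagram F) {obj : ∀ s : D, F.obj ⟨s⟩}
  (p : ∀ j s, obj s ⟶ (X j).obj s)
  (map : ∀ {s t : D} (a : s ⟶ t), (push F a).obj (obj s) ⟶ obj t)

/-- Construct a diagram from a family of jointly monic maps to diagrams. -/
def ofJointlyMono
    (hp : ∀ {s : D} {z : F.obj ⟨s⟩} (g g' : z ⟶ obj s), (∀ j, g ≫ p j s = g' ≫ p j s) → g = g')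
    (hmap : ∀ j {s t : D} (a : s ⟶ t), map a ≫ p j t = (push F a).map (p j s) ≫ (X j).map a) :
    CatDiagram F :=
  have h (j : ι) {s t : D} (a : s ⟶ t) :
      ov a (map a) ≫ vert (p j t) = vert (p j s) ≫ (X j).sec a := by
    rw [sec, ov_comp_vert, vert_comp_ov, hmap]
  ofSec obj map
    (fun s => by
      rw [← ov_idHom]
      refine congrArg _ (hp _ _ fun j => ov_injective ?_)
      rw [← ov_comp_vert, ← ov_comp_vert, h, sec_id, ov_idHom, Category.comp_id, Category.id_comp])
    (fun a b => by
      rw [ov_comp_ov]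
      refine congrArg _ (hp _ _ fun j => ov_injective ?_)
      rw [← ov_comp_vert, ← ov_comp_vert, h, ← ov_comp_ov, Category.assoc, h,
        ← Category.assoc, h, Category.assoc, sec_comp])

variable {X p map}

/-- Construct a map of diagrams using a family of jointly monic maps to diagrams. -/
def Hom.ofJointlyMono {Y Z : CatDiagram F} (f : ∀ s, Y.obj s ⟶ Z.obj s) (g : ∀ j, Hom Y (X j))
    (h : ∀ j, Hom Z (X j))
    (hh : ∀ {s : D} {z : F.obj ⟨s⟩} (g g' : z ⟶ Z.obj s),
      (∀ j, g ≫ (h j).app s = g' ≫ (h j).app s) → g = g')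
    (hf : ∀ j s, f s ≫ (h j).app s = (g j).app s) : Hom Y Z where
  app := f
  naturality a := hh _ _ fun j => by
    rw [Category.assoc, hf, (g j).naturality, Category.assoc, (h j).naturality, ← hf,
      Functor.map_comp, Category.assoc]

end JointlyMono

section JointlyEpi

variable {ι : Type*} (X : ι → CatDiagram F) {obj : ∀ s : D, F.obj ⟨s⟩}
  (i : ∀ j s, (X j).obj s ⟶ obj s)
  (map : ∀ {s t : D} (a : s ⟶ t), (push F a).obj (obj s) ⟶ obj t)

/-- Construct a diagram from a family of (universally) jointly epic maps from diagrams. -/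
def ofJointlyEpi
    (hi : ∀ {s t : D} (a : s ⟶ t) {z : F.obj ⟨t⟩} (g g' : (push F a).obj (obj s) ⟶ z),
      (∀ j, (push F a).map (i j s) ≫ g = (push F a).map (i j s) ≫ g') → g = g')
    (hmap : ∀ j {s t : D} (a : s ⟶ t), (push F a).map (i j s) ≫ map a = (X j).map a ≫ i j t) :
    CatDiagram F :=
  have h (j : ι) {s t : D} (a : s ⟶ t) :
      vert (i j s) ≫ ov a (map a) = (X j).sec a ≫ vert (i j t) := by
    rw [sec, ov_comp_vert, vert_comp_ov, hmap]
  ofSec obj map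
    (fun s => by
      rw [← ov_idHom]
      refine congrArg _ (hi _ _ _ fun j => ov_injective ?_)
      rw [← vert_comp_ov, ← vert_comp_ov, h, sec_id, ov_idHom, Category.comp_id, Category.id_comp])
    (fun a b => by
      rw [ov_comp_ov]
      refine congrArg _ (hi _ _ _ fun j => ov_injective ?_)
      rw [← vert_comp_ov, ← vert_comp_ov, h, ← ov_comp_ov, ← Category.assoc, h,
        Category.assoc, h, ← Category.assoc, sec_comp])

variable {X i map}

/-- Construct a map of diagrams using a family of (universally) jointly epic maps from diagrams. -/
def Hom.ofJointlyEpi {Y Z : CatDiagram F} (f : ∀ s, Y.obj s ⟶ Z.obj s) (g : ∀ j, Hom (X j) Z)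
    (h : ∀ j, Hom (X j) Y)
    (hh : ∀ {s t : D} (a : s ⟶ t) {z : F.obj ⟨t⟩} (g g' : (push F a).obj (Y.obj s) ⟶ z),
      (∀ j, (push F a).map ((h j).app s) ≫ g = (push F a).map ((h j).app s) ≫ g') → g = g')
    (hf : ∀ j s, (h j).app s ≫ f s = (g j).app s) : Hom Y Z where
  app := f
  naturality a := hh a _ _ fun j => by
    rw [← Category.assoc, ← (h j).naturality, Category.assoc, hf, (g j).naturality, ← hf,
      Functor.map_comp, Category.assoc]

end JointlyEpi

section Limits

variable {J : Type u₁} [Category.{v₁} J] (K : J ⥤ CatDiagram F)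

section

variable [∀ s : D, HasLimitsOfShape J (F.obj ⟨s⟩)]

/-- The structure maps of an objectwise limit. -/
noncomputable def limMap {s t : D} (b : s ⟶ t) :
    (push F b).obj (limit (K ⋙ eval F s)) ⟶ limit (K ⋙ eval F t) :=
  limit.lift (K ⋙ eval F t)
    { pt := _
      π :=
        { app := fun j => (push F b).map (limit.π (K ⋙ eval F s) j) ≫ (K.obj j).map b
          naturality := fun j j' f => by
            have h := Hom.naturality (K.map f) b
            have h' := limit.w (K ⋙ eval F s) f
            refine (Category.id_comp _).trans (Eq.trans ?_ (Category.assoc _ _ _).symm)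
            refine Eq.trans ?_ (congrArg ((push F b).map (limit.π (K ⋙ eval F s) j) ≫ ·) h.symm)
            rw [← h', Functor.map_comp]
            exact Category.assoc _ _ _ } }

/-- The cone of the objectwise limit. -/
noncomputable def limCone : Cone K where
  pt := ofJointlyMono K.obj (obj := fun s => limit (K ⋙ eval F s))
    (fun j s => limit.π (K ⋙ eval F s) j) (limMap K) (fun _ _ h => limit.hom_ext h)
    (fun j _ _ _ => limit.lift_π _ j)
  π :=
    { app := fun j =>
        { app := fun s => limit.π (K ⋙ eval F s) j, naturality := fun _ => limit.lift_π _ j }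
      naturality := fun _ _ f => Hom.ext (funext fun s =>
        (Category.id_comp _).trans (limit.w (K ⋙ eval F s) f).symm) }

/-- The objectwise limit is a limit. -/
noncomputable def isLimitLimCone : IsLimit (limCone K) where
  lift c := Hom.ofJointlyMono (fun s => limit.lift _ ((eval F s).mapCone c)) (fun j => c.π.app j)
    (fun j => (limCone K).π.app j) (fun _ _ h => limit.hom_ext h) (fun j _ => limit.lift_π _ j)
  fac _ j := Hom.ext (funext fun _ => limit.lift_π _ j)
  uniq c _ hm := Hom.ext (funext fun s => limit.hom_ext fun j =>
    (congrFun (congrArg Hom.app (hm j)) s).trans (limit.lift_π ((eval F s).mapCone c) j).symm)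

instance : HasLimitsOfShape J (CatDiagram F) where
  has_limit K := ⟨⟨_, isLimitLimCone K⟩⟩

end

section

variable [∀ s : D, HasColimitsOfShape J (F.obj ⟨s⟩)]
  [hF : ∀ ⦃s t : D⦄ (a : s ⟶ t), (push F a).IsLeftAdjoint]

/-- The structure maps of an objectwise colimit. -/
noncomputable def colimMap {s t : D} (b : s ⟶ t) :
    (push F b).obj (colimit (K ⋙ eval F s)) ⟶ colimit (K ⋙ eval F t) :=
  (isColimitOfPreserves (push F b) (colimit.isColimit (K ⋙ eval F s))).desc
    { pt := _
      ι :=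
        { app := fun j => (K.obj j).map b ≫ colimit.ι (K ⋙ eval F t) j
          naturality := fun j j' f => by
            have h := Hom.naturality (K.map f) b
            have h' := colimit.w (K ⋙ eval F t) f
            refine Eq.trans ?_ (Category.comp_id _).symm
            refine (Category.assoc _ _ _).symm.trans
              ((congrArg (· ≫ colimit.ι (K ⋙ eval F t) j') h.symm).trans ?_)
            rw [← h']
            exact Category.assoc _ _ _ } }

lemma map_ι_colimMap {s t : D} (b : s ⟶ t) (j : J) :
    (push F b).map (colimit.ι (K ⋙ eval F s) j) ≫ colimMap K b =
      (K.obj j).map b ≫ colimit.ι (K ⋙ eval F t) j :=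
  (isColimitOfPreserves (push F b) (colimit.isColimit (K ⋙ eval F s))).fac _ j

/-- The cocone of the objectwise colimit. -/
noncomputable def colimCocone : Cocone K where
  pt := ofJointlyEpi K.obj (obj := fun s => colimit (K ⋙ eval F s))
    (fun j s => colimit.ι (K ⋙ eval F s) j) (colimMap K)
    (fun a _ _ _ h =>
      (isColimitOfPreserves (push F a) (colimit.isColimit (K ⋙ eval F _))).hom_ext h)
    (fun j _ _ a => map_ι_colimMap K a j)
  ι :=
    { app := fun j =>
        { app := fun s => colimit.ι (K ⋙ eval F s) j
          naturality := fun a => (map_ι_colimMap K a j).symm }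
      naturality := fun _ _ f => Hom.ext (funext fun s =>
        (colimit.w (K ⋙ eval F s) f).trans (Category.comp_id _).symm) }

/-- The objectwise colimit is a colimit. -/
noncomputable def isColimitColimCocone : IsColimit (colimCocone K) where
  desc c := Hom.ofJointlyEpi (fun s => colimit.desc _ ((eval F s).mapCocone c))
    (fun j => c.ι.app j) (fun j => (colimCocone K).ι.app j)
    (fun a _ _ _ h =>
      (isColimitOfPreserves (push F a) (colimit.isColimit (K ⋙ eval F _))).hom_ext h)
    (fun j _ => colimit.ι_desc _ j)
  fac _ j := Hom.ext (funext fun _ => colimit.ι_desc _ j)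
  uniq c _ hm := Hom.ext (funext fun s => colimit.hom_ext fun j =>
    (congrFun (congrArg Hom.app (hm j)) s).trans (colimit.ι_desc ((eval F s).mapCocone c) j).symm)

include hF in
lemma hasColimitsOfShape : HasColimitsOfShape J (CatDiagram F) where
  has_colimit K := ⟨⟨_, isColimitColimCocone K⟩⟩

end

end Limits

end CatDiagram

/-! ### Free and cofree diagrams, the adjoints of evaluation -/

namespace CatDiagram

variable {D : Type w} [SmallCategory D] {F : Pseudofunctor (LocallyDiscrete D) Cat.{v, u}}

/-- The inverse of the isomorphism `𝟙_* x ≅ x`. -/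
noncomputable def idInv {s : D} (x : F.obj ⟨s⟩) : x ⟶ (push F (𝟙 s)).obj x := inv (idHom x)

instance isIso_idInv {s : D} (x : F.obj ⟨s⟩) : IsIso (idInv x) :=
  inferInstanceAs (IsIso (inv (idHom x)))

lemma idHom_idInv {s : D} (x : F.obj ⟨s⟩) : idHom x ≫ idInv x = 𝟙 _ :=
  IsIso.hom_inv_id _

lemma vert_idInv_comp {s : D} {x z : F.obj ⟨s⟩} (g : (push F (𝟙 s)).obj x ⟶ z) :
    vert (idInv x ≫ g) = ov (𝟙 s) g := by
  rw [vert, idInv, IsIso.hom_inv_id_assoc]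

section Free

variable [∀ s : D, HasColimitsOfSize.{w, w} (F.obj ⟨s⟩)] {s : D}

/-- The values of the free diagram on an object `x` at `s`. -/
noncomputable def freeObj (x : F.obj ⟨s⟩) (t : D) : F.obj ⟨t⟩ :=
  ∐ fun a : s ⟶ t => (push F a).obj x

/-- The inclusions into the values of a free diagram. -/
noncomputable def freeι (x : F.obj ⟨s⟩) {t : D} (a : s ⟶ t) :
    (push F a).obj x ⟶ freeObj x t :=
  Sigma.ι (fun a : s ⟶ t => (push F a).obj x) a

/-- Maps out of the values of a free diagram. -/
noncomputable def freeDesc {x : F.obj ⟨s⟩} {t : D} {z : F.obj ⟨t⟩}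
    (g : ∀ a : s ⟶ t, (push F a).obj x ⟶ z) : freeObj x t ⟶ z :=
  Sigma.desc g

lemma freeι_freeDesc {x : F.obj ⟨s⟩} {t : D} {z : F.obj ⟨t⟩}
    (g : ∀ a : s ⟶ t, (push F a).obj x ⟶ z) (a : s ⟶ t) : freeι x a ≫ freeDesc g = g a :=
  Sigma.ι_desc _ a

lemma free_ext {x : F.obj ⟨s⟩} {t : D} {z : F.obj ⟨t⟩} {g g' : freeObj x t ⟶ z}
    (h : ∀ a, freeι x a ≫ g = freeι x a ≫ g') : g = g' :=
  Sigma.hom_ext _ _ h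

lemma ov_freeι_congr (x : F.obj ⟨s⟩) {t : D} {a a' : s ⟶ t} (h : a = a') :
    ov a (freeι x a) = ov a' (freeι x a') := by
  subst h; rfl

variable [hF : ∀ ⦃s t : D⦄ (a : s ⟶ t), (push F a).IsLeftAdjoint]

/-- Transposing along the adjunction of `b_*` reduces this to maps out of the coproduct itself. -/
lemma push_free_ext {x : F.obj ⟨s⟩} {t t' : D} {b : t ⟶ t'} {z : F.obj ⟨t'⟩}
    {g g' : (push F b).obj (freeObj x t) ⟶ z}
    (h : ∀ a, ov a (freeι x a) ≫ ov b g = ov a (freeι x a) ≫ ov b g') : g = g' := by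
  apply ((Adjunction.ofIsLeftAdjoint (push F b)).homEquiv _ _).injective
  refine free_ext fun a => ?_
  rw [← Adjunction.homEquiv_naturality_left, ← Adjunction.homEquiv_naturality_left]
  have := ov_injective (h a)
  exact congrArg _ ((cancel_epi (compHom a b x)).1 this)

/-- The structure maps of a free diagram. -/
noncomputable def freeMap (x : F.obj ⟨s⟩) {t t' : D} (b : t ⟶ t') :
    (push F b).obj (freeObj x t) ⟶ freeObj x t' :=
  ((Adjunction.ofIsLeftAdjoint (push F b)).homEquiv _ _).symm
    (freeDesc fun a => (Adjunction.ofIsLeftAdjoint (push F b)).homEquiv _ _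
      (inv (compHom a b x) ≫ freeι x (a ≫ b)))

lemma freeι_freeMap (x : F.obj ⟨s⟩) {t t' : D} (a : s ⟶ t) (b : t ⟶ t') :
    ov a (freeι x a) ≫ ov b (freeMap x b) = ov (a ≫ b) (freeι x (a ≫ b)) := by
  have h : (push F b).map (freeι x a) ≫ freeMap x b =
      inv (compHom a b x) ≫ freeι x (a ≫ b) := by
    rw [freeMap, ← Adjunction.homEquiv_naturality_left_symm, Equiv.symm_apply_eq, freeι_freeDesc]
  rw [ov_comp_ov, h, IsIso.hom_inv_id_assoc]

/-- The free diagram on an object `x` at `s`. -/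
noncomputable abbrev free (x : F.obj ⟨s⟩) : CatDiagram F :=
  ofSec (freeObj x) (freeMap x)
    (fun t => by
      rw [← ov_idHom]
      refine congrArg _ (push_free_ext fun a => ?_)
      rw [freeι_freeMap, ov_idHom]
      exact (ov_freeι_congr x (Category.comp_id a)).trans (Category.comp_id _).symm)
    (fun b c => by
      rw [ov_comp_ov]
      refine congrArg _ (push_free_ext fun a => ?_)
      rw [freeι_freeMap, ← ov_comp_ov, reassoc_of% @freeι_freeMap, freeι_freeMap]
      exact ov_freeι_congr x (Category.assoc a b c).symm)

lemma freeι_sec (x : F.obj ⟨s⟩) {t t' : D} (a : s ⟶ t) (b : t ⟶ t') :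
    ov a (freeι x a) ≫ (free x).sec b = ov (a ≫ b) (freeι x (a ≫ b)) :=
  freeι_freeMap x a b

/-- The components of the map from a free diagram corresponding to a map `g`. -/
noncomputable def freeApp {x : F.obj ⟨s⟩} {X : CatDiagram F} (g : x ⟶ X.obj s) (t : D) :
    freeObj x t ⟶ X.obj t :=
  freeDesc fun a => (push F a).map g ≫ X.map a

omit hF in
lemma freeι_freeApp {x : F.obj ⟨s⟩} {X : CatDiagram F} (g : x ⟶ X.obj s) {t : D} (a : s ⟶ t) :
    ov a (freeι x a) ≫ vert (freeApp g t) = vert g ≫ X.sec a := by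
  rw [ov_comp_vert, freeApp, freeι_freeDesc, sec, vert_comp_ov]

/-- The universal property of free diagrams. -/
noncomputable def freeEquiv (x : F.obj ⟨s⟩) (X : CatDiagram F) :
    (free x ⟶ X) ≃ (x ⟶ X.obj s) where
  toFun f := idInv x ≫ freeι x (𝟙 s) ≫ Hom.app f s
  invFun g := Hom.ofVert (X := free x) (freeApp g) fun {t t'} b => by
    have h : (freeMap x b ≫ freeApp g t') = (push F b).map (freeApp g t) ≫ X.map b := by
      refine push_free_ext fun a => ?_
      rw [← ov_comp_vert, ← vert_comp_ov, reassoc_of% @freeι_freeMap, freeι_freeApp, reassoc_of% @freeι_freeApp,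
        sec_comp]
      rfl
    exact (ov_comp_vert b _ _).trans ((congrArg (ov b) h).trans (vert_comp_ov b _ _).symm)
  left_inv f := by
    refine Hom.ext (funext fun t => free_ext fun a => ov_injective ?_)
    change ov a (freeι x a ≫ freeApp _ t) = ov a (freeι x a ≫ Hom.app f t)
    rw [← ov_comp_vert, freeι_freeApp, vert_idInv_comp, ← ov_comp_vert, Category.assoc,
      ← Hom.sec_comp_vert, reassoc_of% @freeι_sec, ov_freeι_congr x (Category.id_comp a), ov_comp_vert]
  right_inv g := by
    refine vert_injective ?_
    rw [vert_idInv_comp, ← ov_comp_vert]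
    refine (freeι_freeApp g (𝟙 s)).trans ?_
    rw [sec_id, Category.comp_id]

lemma freeEquiv_apply (x : F.obj ⟨s⟩) (X : CatDiagram F) (f : free x ⟶ X) :
    freeEquiv x X f = idInv x ≫ freeι x (𝟙 s) ≫ Hom.app f s := rfl

lemma freeEquiv_comp (x : F.obj ⟨s⟩) (X Y : CatDiagram F) (g : X ⟶ Y) (f : free x ⟶ X) :
    freeEquiv x Y (f ≫ g) = freeEquiv x X f ≫ (eval F s).map g := by
  rw [freeEquiv_apply, freeEquiv_apply, comp_app, eval_map]
  exact (congrArg (idInv x ≫ ·) (Category.assoc _ _ _).symm).trans (Category.assoc _ _ _).symm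

variable (F) in
/-- The free diagram functor, left adjoint to evaluation at `s`. -/
noncomputable def freeFunctor (s : D) : F.obj ⟨s⟩ ⥤ CatDiagram F :=
  Adjunction.leftAdjointOfEquiv (G := eval F s) freeEquiv freeEquiv_comp

variable (F) in
/-- The free diagram functor is left adjoint to evaluation at `s`. -/
noncomputable def freeAdj (s : D) : freeFunctor F s ⊣ eval F s :=
  Adjunction.adjunctionOfEquivLeft (G := eval F s) freeEquiv freeEquiv_comp

/-- The coproduct at `s` has the single summand `𝟙_* x ≅ x`. -/
lemma isIso_freeAdj_unit_app (h : ∀ a : s ⟶ s, a = 𝟙 s) (x : F.obj ⟨s⟩) :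
    IsIso ((freeAdj F s).unit.app x) := by
  have e : (freeAdj F s).unit.app x = idInv x ≫ freeι x (𝟙 s) :=
    (freeEquiv_apply x _ (𝟙 (free x))).trans <|
      congrArg (idInv x ≫ ·) (Category.comp_id (freeι x (𝟙 s)))
  have hι : IsIso (freeι x (𝟙 s)) := by
    refine ⟨freeDesc fun a => (push F a).map (𝟙 x) ≫ eqToHom (by rw [h a]), ?_,
      free_ext fun a => ?_⟩
    · rw [freeι_freeDesc, CategoryTheory.Functor.map_id, eqToHom_refl, Category.id_comp]
    · obtain rfl := h a
      rw [← Category.assoc, freeι_freeDesc, CategoryTheory.Functor.map_id, eqToHom_refl,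
        Category.id_comp, Category.id_comp, Category.comp_id]
  rw [e]
  exact IsIso.comp_isIso' (isIso_idInv x) hι

/-- Both values at `t` are empty coproducts, hence initial. -/
lemma isIso_freeFunctor_map_app {t : D} (h : IsEmpty (s ⟶ t)) {x y : F.obj ⟨s⟩} (i : x ⟶ y) :
    IsIso ((eval F t).map ((freeFunctor F s).map i)) := by
  change IsIso (Hom.app ((freeFunctor F s).map i) t)
  refine ⟨freeDesc (fun a => h.elim a), free_ext fun a => h.elim a, free_ext fun a => h.elim a⟩

/-- The action of the free diagram functor on maps. -/
noncomputable def freeMapApp {x y : F.obj ⟨s⟩} (i : x ⟶ y) (t : D) : freeObj x t ⟶ freeObj y t :=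
  freeDesc fun a => (push F a).map i ≫ freeι y a

omit hF in
lemma freeι_freeMapApp {x y : F.obj ⟨s⟩} (i : x ⟶ y) {t : D} (a : s ⟶ t) :
    freeι x a ≫ freeMapApp i t = (push F a).map i ≫ freeι y a :=
  freeι_freeDesc _ a

lemma freeFunctor_map_app {x y : F.obj ⟨s⟩} (i : x ⟶ y) (t : D) :
    (eval F t).map ((freeFunctor F s).map i) = freeMapApp i t := by
  refine free_ext fun a => ov_injective ?_
  refine (ov_comp_vert a (freeι x a) _).symm.trans ?_
  refine (freeι_freeApp (X := free y) (i ≫ freeEquiv y (free y) (𝟙 (free y))) a).trans ?_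
  have e : freeEquiv y (free y) (𝟙 (free y)) = idInv y ≫ freeι y (𝟙 s) :=
    congrArg (idInv y ≫ ·) (Category.comp_id (freeι y (𝟙 s)))
  rw [e, vert_comp, vert_idInv_comp, Category.assoc, freeι_sec,
    ov_freeι_congr y (Category.id_comp a), vert_comp_ov]
  exact congrArg (ov a) (freeι_freeMapApp i a).symm

-- Lifts are chosen on each summand separately. This shows that free diagrams on (trivial)
-- cofibrations are objectwise (trivial) cofibrations.
omit hF in
lemma hasLiftingProperty_freeMapApp {t : D} {x y : F.obj ⟨s⟩} (i : x ⟶ y) {z z' : F.obj ⟨t⟩}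
    (p : z ⟶ z') (h : ∀ a : s ⟶ t, HasLiftingProperty ((push F a).map i) p) :
    HasLiftingProperty (freeMapApp i t) p where
  sq_hasLift {f g} sq := by
    have w (a : s ⟶ t) : (freeι x a ≫ f) ≫ p = (push F a).map i ≫ freeι y a ≫ g := by
      rw [Category.assoc, sq.w, reassoc_of% @freeι_freeMapApp]
    let l (a : s ⟶ t) := (CommSq.mk (w a)).lift
    have l₁ (a : s ⟶ t) : (push F a).map i ≫ l a = freeι x a ≫ f := CommSq.fac_left _
    have l₂ (a : s ⟶ t) : l a ≫ p = freeι y a ≫ g := CommSq.fac_right _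
    refine ⟨⟨freeDesc l, free_ext fun a => ?_, free_ext fun a => ?_⟩⟩
    · rw [reassoc_of% @freeι_freeMapApp, freeι_freeDesc, l₁]
    · rw [← Category.assoc, freeι_freeDesc, l₂]

end Free

section Cofree

variable [∀ s : D, HasLimitsOfSize.{w, w} (F.obj ⟨s⟩)]
  [hF : ∀ ⦃s t : D⦄ (a : s ⟶ t), (push F a).IsLeftAdjoint] {s : D}

/-- The values of the cofree diagram on an object `y` at `s`. -/
noncomputable def cofreeObj (y : F.obj ⟨s⟩) (t : D) : F.obj ⟨t⟩ :=
  ∏ᶜ fun a : t ⟶ s => (push F a).rightAdjoint.obj y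

/-- The projections from the values of a cofree diagram. -/
noncomputable def cofreeπ (y : F.obj ⟨s⟩) {t : D} (a : t ⟶ s) :
    cofreeObj y t ⟶ (push F a).rightAdjoint.obj y :=
  Pi.π (fun a : t ⟶ s => (push F a).rightAdjoint.obj y) a

/-- The adjuncts of the projections from the values of a cofree diagram. -/
noncomputable def cofreeε (y : F.obj ⟨s⟩) {t : D} (a : t ⟶ s) :
    (push F a).obj (cofreeObj y t) ⟶ y :=
  ((Adjunction.ofIsLeftAdjoint (push F a)).homEquiv _ _).symm (cofreeπ y a)

/-- Maps to the values of a cofree diagram. -/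
noncomputable def cofreeLift {y : F.obj ⟨s⟩} {t : D} {z : F.obj ⟨t⟩}
    (g : ∀ a : t ⟶ s, (push F a).obj z ⟶ y) : z ⟶ cofreeObj y t :=
  Pi.lift fun a => (Adjunction.ofIsLeftAdjoint (push F a)).homEquiv _ _ (g a)

lemma cofreeLift_cofreeε {y : F.obj ⟨s⟩} {t : D} {z : F.obj ⟨t⟩}
    (g : ∀ a : t ⟶ s, (push F a).obj z ⟶ y) (a : t ⟶ s) :
    (push F a).map (cofreeLift g) ≫ cofreeε y a = g a := by
  rw [cofreeε, ← Adjunction.homEquiv_naturality_left_symm, Equiv.symm_apply_eq]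
  exact Pi.lift_π _ a

lemma cofree_ext {y : F.obj ⟨s⟩} {t : D} {z : F.obj ⟨t⟩} {g g' : z ⟶ cofreeObj y t}
    (h : ∀ a : t ⟶ s, (push F a).map g ≫ cofreeε y a = (push F a).map g' ≫ cofreeε y a) :
    g = g' := by
  refine Pi.hom_ext _ _ fun a => ?_
  have := h a
  rw [cofreeε, ← Adjunction.homEquiv_naturality_left_symm,
    ← Adjunction.homEquiv_naturality_left_symm] at this
  exact Equiv.injective _ this

lemma ov_cofreeε_congr (y : F.obj ⟨s⟩) {t : D} {a a' : t ⟶ s} (h : a = a') :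
    ov a (cofreeε y a) = ov a' (cofreeε y a') := by
  subst h; rfl

lemma cofree_ext_ov {y : F.obj ⟨s⟩} {t t' : D} {b : t' ⟶ t} {z : F.obj ⟨t'⟩}
    {g g' : (push F b).obj z ⟶ cofreeObj y t}
    (h : ∀ a, ov b g ≫ ov a (cofreeε y a) = ov b g' ≫ ov a (cofreeε y a)) : g = g' := by
  refine cofree_ext fun a => ?_
  have := ov_injective (h a)
  exact (cancel_epi (compHom b a z)).1 this

/-- The structure maps of a cofree diagram. -/
noncomputable def cofreeMap (y : F.obj ⟨s⟩) {t t' : D} (b : t ⟶ t') :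
    (push F b).obj (cofreeObj y t) ⟶ cofreeObj y t' :=
  cofreeLift fun a => inv (compHom b a _) ≫ cofreeε y (b ≫ a)

lemma cofreeMap_cofreeε (y : F.obj ⟨s⟩) {t t' : D} (b : t ⟶ t') (a : t' ⟶ s) :
    ov b (cofreeMap y b) ≫ ov a (cofreeε y a) = ov (b ≫ a) (cofreeε y (b ≫ a)) := by
  rw [ov_comp_ov, cofreeMap, cofreeLift_cofreeε, IsIso.hom_inv_id_assoc]

/-- The cofree diagram on an object `y` at `s`. -/
noncomputable abbrev cofree (y : F.obj ⟨s⟩) : CatDiagram F :=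
  ofSec (cofreeObj y) (cofreeMap y)
    (fun t => by
      rw [← ov_idHom]
      refine congrArg _ (cofree_ext_ov fun a => ?_)
      rw [cofreeMap_cofreeε, ov_idHom]
      exact (ov_cofreeε_congr y (Category.id_comp a)).trans (Category.id_comp _).symm)
    (fun b c => by
      rw [ov_comp_ov]
      refine congrArg _ (cofree_ext_ov fun a => ?_)
      rw [cofreeMap_cofreeε, ← ov_comp_ov, Category.assoc (ov b _), cofreeMap_cofreeε,
        cofreeMap_cofreeε]
      exact ov_cofreeε_congr y (Category.assoc b c a))

lemma sec_cofreeε (y : F.obj ⟨s⟩) {t t' : D} (b : t ⟶ t') (a : t' ⟶ s) :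
    (cofree y).sec b ≫ ov a (cofreeε y a) = ov (b ≫ a) (cofreeε y (b ≫ a)) :=
  cofreeMap_cofreeε y b a

/-- The components of the map to a cofree diagram corresponding to a map `g`. -/
noncomputable def cofreeApp {y : F.obj ⟨s⟩} {X : CatDiagram F} (g : X.obj s ⟶ y) (t : D) :
    X.obj t ⟶ cofreeObj y t :=
  cofreeLift fun a => X.map a ≫ g

lemma cofreeApp_cofreeε {y : F.obj ⟨s⟩} {X : CatDiagram F} (g : X.obj s ⟶ y) {t : D} (a : t ⟶ s) :
    vert (cofreeApp g t) ≫ ov a (cofreeε y a) = X.sec a ≫ vert g := by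
  rw [vert_comp_ov, cofreeApp, cofreeLift_cofreeε, sec, ov_comp_vert]

/-- The universal property of cofree diagrams. -/
noncomputable def cofreeEquiv (X : CatDiagram F) (y : F.obj ⟨s⟩) :
    (X.obj s ⟶ y) ≃ (X ⟶ cofree y) where
  toFun g := Hom.ofVert (Y := cofree y) (cofreeApp g) fun {t t'} b => by
    have h : X.map b ≫ cofreeApp g t' = (push F b).map (cofreeApp g t) ≫ cofreeMap y b := by
      refine cofree_ext_ov fun a => ?_
      rw [← ov_comp_vert, ← vert_comp_ov, Category.assoc, cofreeApp_cofreeε, Category.assoc,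
        cofreeMap_cofreeε, cofreeApp_cofreeε, sec_comp, Category.assoc]
      rfl
    exact (ov_comp_vert b _ _).trans ((congrArg (ov b) h).trans (vert_comp_ov b _ _).symm)
  invFun f := Hom.app f s ≫ idInv (cofreeObj y s) ≫ cofreeε y (𝟙 s)
  left_inv g := by
    refine vert_injective ?_
    rw [vert_comp, vert_idInv_comp]
    refine (cofreeApp_cofreeε g (𝟙 s)).trans ?_
    rw [sec_id, Category.id_comp]
  right_inv f := by
    refine Hom.ext (funext fun t => cofree_ext fun a => ov_injective ?_)
    change ov a ((push F a).map (cofreeApp _ t) ≫ cofreeε y a) =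
      ov a ((push F a).map (Hom.app f t) ≫ cofreeε y a)
    rw [← vert_comp_ov, cofreeApp_cofreeε, vert_comp, vert_idInv_comp]
    refine ((reassoc_of% Hom.sec_comp_vert f a) _).trans ?_
    rw [sec_cofreeε, ov_cofreeε_congr y (Category.comp_id a)]
    exact vert_comp_ov a _ _

lemma cofreeEquiv_comp (X Y : CatDiagram F) (y : F.obj ⟨s⟩) (f : X ⟶ Y) (g : Y.obj s ⟶ y) :
    cofreeEquiv X y ((eval F s).map f ≫ g) = f ≫ cofreeEquiv Y y g := by
  refine ((cofreeEquiv X y).eq_symm_apply.1 ?_)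
  conv_lhs => rw [← (cofreeEquiv Y y).symm_apply_apply g]
  exact (Category.assoc _ _ _).symm

variable (F) in
/-- The cofree diagram functor, right adjoint to evaluation at `s`. -/
noncomputable def cofreeFunctor (s : D) : F.obj ⟨s⟩ ⥤ CatDiagram F :=
  Adjunction.rightAdjointOfEquiv (F := eval F s) cofreeEquiv cofreeEquiv_comp

variable (F) in
/-- The cofree diagram functor is right adjoint to evaluation at `s`. -/
noncomputable def cofreeAdj (s : D) : eval F s ⊣ cofreeFunctor F s :=
  Adjunction.adjunctionOfEquivRight (F := eval F s) cofreeEquiv cofreeEquiv_comp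

lemma cofreeEquiv_symm_apply (X : CatDiagram F) (y : F.obj ⟨s⟩) (f : X ⟶ cofree y) :
    (cofreeEquiv X y).symm f = Hom.app f s ≫ idInv (cofreeObj y s) ≫ cofreeε y (𝟙 s) := rfl

/-- The product at `s` has the single factor indexed by `𝟙 s`, and `𝟙_*`, hence its right adjoint,
is isomorphic to the identity. -/
lemma isIso_cofreeε (h : ∀ a : s ⟶ s, a = 𝟙 s) (y : F.obj ⟨s⟩) :
    IsIso (idInv (cofreeObj y s) ≫ cofreeε y (𝟙 s)) := by
  refine ⟨cofreeLift fun a => (push F a).map (𝟙 y) ≫ eqToHom (by rw [h a]) ≫ idHom y, ?_, ?_⟩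
  · refine cofree_ext fun a => ?_
    obtain rfl := h a
    rw [Functor.map_comp, Category.assoc, cofreeLift_cofreeε, CategoryTheory.Functor.map_id,
      eqToHom_refl, Category.id_comp, Category.id_comp, idHom_naturality, reassoc_of% @idHom_idInv,
      CategoryTheory.Functor.map_id, Category.id_comp]
  · refine vert_injective ?_
    rw [vert_comp, vert_idInv_comp, vert_comp_ov, cofreeLift_cofreeε, CategoryTheory.Functor.map_id,
      eqToHom_refl, Category.id_comp, Category.id_comp, ov_idHom, vert_id]

lemma isIso_cofreeAdj_counit_app (h : ∀ a : s ⟶ s, a = 𝟙 s) (y : F.obj ⟨s⟩) :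
    IsIso ((cofreeAdj F s).counit.app y) := by
  have e : (cofreeAdj F s).counit.app y = idInv (cofreeObj y s) ≫ cofreeε y (𝟙 s) :=
    (cofreeEquiv_symm_apply _ y (𝟙 (cofree y))).trans (Category.id_comp _)
  rw [e]
  exact isIso_cofreeε h y

lemma isIso_cofreeFunctor_map_app {t : D} (h : IsEmpty (t ⟶ s)) {x y : F.obj ⟨s⟩} (p : x ⟶ y) :
    IsIso ((eval F t).map ((cofreeFunctor F s).map p)) := by
  change IsIso (Hom.app ((cofreeFunctor F s).map p) t)
  exact ⟨cofreeLift (fun a => h.elim a), cofree_ext fun a => h.elim a,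
    cofree_ext fun a => h.elim a⟩

/-- The action of the cofree diagram functor on maps. -/
noncomputable def cofreeMapApp {x y : F.obj ⟨s⟩} (p : x ⟶ y) (t : D) :
    cofreeObj x t ⟶ cofreeObj y t :=
  cofreeLift fun a => cofreeε x a ≫ p

lemma cofreeMapApp_cofreeε {x y : F.obj ⟨s⟩} (p : x ⟶ y) {t : D} (a : t ⟶ s) :
    (push F a).map (cofreeMapApp p t) ≫ cofreeε y a = cofreeε x a ≫ p :=
  cofreeLift_cofreeε _ a

lemma cofreeFunctor_map_app {x y : F.obj ⟨s⟩} (p : x ⟶ y) (t : D) :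
    (eval F t).map ((cofreeFunctor F s).map p) = cofreeMapApp p t := by
  refine cofree_ext fun a => ov_injective ?_
  refine (vert_comp_ov a _ (cofreeε y a)).symm.trans ?_
  refine (cofreeApp_cofreeε (X := cofree x) ((cofreeEquiv (cofree x) x).symm (𝟙 (cofree x)) ≫ p)
    a).trans ?_
  have e : (cofreeEquiv (cofree x) x).symm (𝟙 (cofree x)) =
      idInv (cofreeObj x s) ≫ cofreeε x (𝟙 s) := Category.id_comp _
  rw [e, vert_comp, vert_idInv_comp, reassoc_of% @sec_cofreeε,
    ov_cofreeε_congr x (Category.comp_id a), ov_comp_vert]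
  exact congrArg (ov a) (cofreeMapApp_cofreeε p a).symm

/-- A map into the product is a family of maps out of the `a_*`, so the lifting problem splits into
one problem for each `a`, after transposition. -/
lemma hasLiftingProperty_cofreeMapApp {t : D} {x y : F.obj ⟨s⟩} (p : x ⟶ y) {z z' : F.obj ⟨t⟩}
    (i : z ⟶ z') (h : ∀ a : t ⟶ s, HasLiftingProperty ((push F a).map i) p) :
    HasLiftingProperty i (cofreeMapApp p t) where
  sq_hasLift {f g} sq := by
    have w (a : t ⟶ s) : ((push F a).map f ≫ cofreeε x a) ≫ p =
        (push F a).map i ≫ (push F a).map g ≫ cofreeε y a := by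
      rw [Category.assoc, ← cofreeMapApp_cofreeε, ← Functor.map_comp_assoc, sq.w,
        Functor.map_comp_assoc]
    let l (a : t ⟶ s) := (CommSq.mk (w a)).lift
    have l₁ (a : t ⟶ s) : (push F a).map i ≫ l a = (push F a).map f ≫ cofreeε x a :=
      CommSq.fac_left _
    have l₂ (a : t ⟶ s) : l a ≫ p = (push F a).map g ≫ cofreeε y a := CommSq.fac_right _
    refine ⟨⟨cofreeLift l, cofree_ext fun a => ?_, cofree_ext fun a => ?_⟩⟩
    · rw [Functor.map_comp, Category.assoc, cofreeLift_cofreeε, l₁]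
    · rw [Functor.map_comp, Category.assoc, cofreeMapApp_cofreeε, ← Category.assoc,
        cofreeLift_cofreeε, l₂]

end Cofree

end CatDiagram

/-! ### The adjunction on diagrams induced by objectwise adjunctions -/

namespace CatDiagram

variable {D : Type w} [SmallCategory D] {F G : Pseudofunctor (LocallyDiscrete D) Cat.{v, u}}
  (L : Pseudofunctor.StrongTrans F G)

/-- The component of a transformation at `s`. -/
abbrev comp (s : D) : F.obj ⟨s⟩ ⥤ G.obj ⟨s⟩ := (L.app ⟨s⟩).toFunctor

/-- The isomorphism `a_* L(s) x ≅ L(t) a_* x`. -/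
def natHom {s t : D} (a : s ⟶ t) (x : F.obj ⟨s⟩) :
    (push G a).obj ((comp L s).obj x) ⟶ (comp L t).obj ((push F a).obj x) :=
  (L.naturality a.toLoc).inv.toNatTrans.app x

instance isIso_natHom {s t : D} (a : s ⟶ t) (x : F.obj ⟨s⟩) : IsIso (natHom L a x) :=
  inferInstanceAs (IsIso ((L.naturality a.toLoc).inv.toNatTrans.app x))

/-- The action of a transformation on maps in the Grothendieck construction. -/
def totMap {s t : D} {x : F.obj ⟨s⟩} {y : F.obj ⟨t⟩} (f : tot x ⟶ tot y) :
    tot ((comp L s).obj x) ⟶ tot ((comp L t).obj y) :=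
  (Pseudofunctor.Grothendieck.map L).map f

lemma totMap_id {s : D} (x : F.obj ⟨s⟩) : totMap L (𝟙 (tot x)) = 𝟙 _ :=
  (Pseudofunctor.Grothendieck.map L).map_id _

lemma totMap_comp {r s t : D} {x : F.obj ⟨r⟩} {y : F.obj ⟨s⟩} {z : F.obj ⟨t⟩}
    (f : tot x ⟶ tot y) (g : tot y ⟶ tot z) : totMap L (f ≫ g) = totMap L f ≫ totMap L g :=
  (Pseudofunctor.Grothendieck.map L).map_comp _ _

lemma totMap_ov {s t : D} (a : s ⟶ t) {x : F.obj ⟨s⟩} {y : F.obj ⟨t⟩}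
    (g : (push F a).obj x ⟶ y) :
    totMap L (ov a g) = ov a (natHom L a x ≫ (comp L t).map g) := rfl

lemma totMap_vert {s : D} {x y : F.obj ⟨s⟩} (f : x ⟶ y) :
    totMap L (vert f) = vert ((comp L s).map f) := by
  rw [vert, totMap_ov, Functor.map_comp, ← Category.assoc]
  exact congrArg (fun h => ov (𝟙 s) (h ≫ _)) (naturality_id_inv_app L s x)

section RightAdjoint

variable {L} {R : ∀ s : D, G.obj ⟨s⟩ ⥤ F.obj ⟨s⟩} (adj : ∀ s, comp L s ⊣ R s)

/-- The transpose of a map in a fiber. -/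
def transpose {s : D} {x : F.obj ⟨s⟩} {y : G.obj ⟨s⟩} (f : x ⟶ (R s).obj y) :
    (comp L s).obj x ⟶ y :=
  ((adj s).homEquiv x y).symm f

/-- The counit of an adjunction in a fiber. -/
def counit {s : D} (y : G.obj ⟨s⟩) : (comp L s).obj ((R s).obj y) ⟶ y :=
  (adj s).counit.app y

lemma map_comp_counit {s : D} {x : F.obj ⟨s⟩} {y : G.obj ⟨s⟩} (f : x ⟶ (R s).obj y) :
    (comp L s).map f ≫ counit adj y = transpose adj f :=
  ((adj s).homEquiv_counit x y f).symm

/-- Up to the isomorphism `natHom`, applying `L` and then the counit is transposition, which is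
injective. -/
lemma ext_of_totMap_comp_counit {s t : D} {a : s ⟶ t} {x : F.obj ⟨s⟩} {y : G.obj ⟨t⟩}
    {g g' : (push F a).obj x ⟶ (R t).obj y}
    (h : totMap L (ov a g) ≫ vert (counit adj y) = totMap L (ov a g') ≫ vert (counit adj y)) :
    g = g' := by
  rw [totMap_ov, totMap_ov, ov_comp_vert, ov_comp_vert] at h
  have h' := ov_injective h
  rw [Category.assoc, Category.assoc, map_comp_counit, map_comp_counit] at h'
  exact ((adj t).homEquiv _ _).symm.injective ((cancel_epi (natHom L a x)).1 h')

/-- The structure maps of the image of a diagram by the right adjoint. -/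
noncomputable def rightMap (Y : CatDiagram G) {s t : D} (a : s ⟶ t) :
    (push F a).obj ((R s).obj (Y.obj s)) ⟶ (R t).obj (Y.obj t) :=
  (adj t).homEquiv _ _ (inv (natHom L a ((R s).obj (Y.obj s))) ≫
    (push G a).map (counit adj (Y.obj s)) ≫ Y.map a)

/-- With `ext_of_totMap_comp_counit`, this characterizes `rightMap` as the mate of the structure map
of `Y`, so its coherence laws follow from those of `sec`. -/
lemma totMap_rightMap (Y : CatDiagram G) {s t : D} (a : s ⟶ t) :
    totMap L (ov a (rightMap adj Y a)) ≫ vert (counit adj (Y.obj t)) =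
      vert (counit adj (Y.obj s)) ≫ Y.sec a := by
  rw [totMap_ov, ov_comp_vert, Category.assoc, map_comp_counit, transpose, rightMap,
    Equiv.symm_apply_apply, IsIso.hom_inv_id_assoc, sec, vert_comp_ov]

/-- The image of a diagram by the right adjoint. -/
noncomputable abbrev rightObj (Y : CatDiagram G) : CatDiagram F :=
  ofSec (fun s => (R s).obj (Y.obj s)) (rightMap adj Y)
    (fun s => by
      rw [← ov_idHom]
      refine congrArg _ (ext_of_totMap_comp_counit adj ?_)
      rw [totMap_rightMap, sec_id, ov_idHom, totMap_id, Category.comp_id, Category.id_comp])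
    (fun a b => by
      rw [ov_comp_ov]
      refine congrArg _ (ext_of_totMap_comp_counit adj ?_)
      rw [totMap_rightMap, ← ov_comp_ov, totMap_comp, Category.assoc, totMap_rightMap,
        reassoc_of% @totMap_rightMap, sec_comp])

lemma totMap_vert_comp_counit {s : D} {x : F.obj ⟨s⟩} {y : G.obj ⟨s⟩} (f : x ⟶ (R s).obj y) :
    totMap L (vert f) ≫ vert (counit adj y) = vert (transpose adj f) := by
  rw [totMap_vert, ← vert_comp, map_comp_counit]

/-- Naturality passes through transposition: applying `L` and the counit to the two sides of the
first square gives the two sides of the second. -/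
lemma sec_comp_vert_iff (X : CatDiagram F) (Y : CatDiagram G)
    (f : ∀ s, X.obj s ⟶ (R s).obj (Y.obj s)) {s t : D} (a : s ⟶ t) :
    X.sec a ≫ vert (f t) = vert (f s) ≫ ov a (rightMap adj Y a) ↔
      totMap L (X.sec a) ≫ vert (transpose adj (f t)) = vert (transpose adj (f s)) ≫ Y.sec a := by
  have h₁ : totMap L (X.sec a ≫ vert (f t)) ≫ vert (counit adj (Y.obj t)) =
      totMap L (X.sec a) ≫ vert (transpose adj (f t)) := by
    rw [totMap_comp, Category.assoc, totMap_vert_comp_counit]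
  have h₂ : totMap L (vert (f s) ≫ ov a (rightMap adj Y a)) ≫ vert (counit adj (Y.obj t)) =
      vert (transpose adj (f s)) ≫ Y.sec a := by
    rw [totMap_comp, Category.assoc, totMap_rightMap, ← Category.assoc, totMap_vert_comp_counit]
  rw [← h₁, ← h₂]
  refine ⟨fun h => by rw [h], fun h => ?_⟩
  rw [sec, ov_comp_vert, vert_comp_ov] at h ⊢
  exact congrArg _ (ext_of_totMap_comp_counit adj h)

lemma mapObj_sec_comp_vert_iff (X : CatDiagram F) (Y : CatDiagram G)
    (f : ∀ s, (comp L s).obj (X.obj s) ⟶ Y.obj s) {s t : D} (a : s ⟶ t) :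
    X.sec a ≫ vert ((adj t).homEquiv _ _ (f t)) =
        vert ((adj s).homEquiv _ _ (f s)) ≫ ov a (rightMap adj Y a) ↔
      totMap L (X.sec a) ≫ vert (f t) = vert (f s) ≫ Y.sec a := by
  rw [sec_comp_vert_iff adj X Y (fun s => (adj s).homEquiv _ _ (f s)), transpose, transpose,
    Equiv.symm_apply_apply, Equiv.symm_apply_apply]

/-- The objectwise adjunction bijection. -/
noncomputable def mapEquiv (X : CatDiagram F) (Y : CatDiagram G) :
    ((mapFunctor L).obj X ⟶ Y) ≃ (X ⟶ rightObj adj Y) where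
  toFun f := Hom.ofVert (Y := rightObj adj Y) (fun s => (adj s).homEquiv _ _ (Hom.app f s))
    fun a => (mapObj_sec_comp_vert_iff adj X Y (Hom.app f) a).2 (Hom.sec_comp_vert f a)
  invFun f := Hom.ofVert (X := mapObj L X) (fun s => transpose adj (Hom.app f s))
    fun a => (sec_comp_vert_iff adj X Y _ a).1 (Hom.sec_comp_vert f a)
  left_inv _ := Hom.ext (funext fun _ => Equiv.symm_apply_apply _ _)
  right_inv _ := Hom.ext (funext fun _ => Equiv.apply_symm_apply _ _)

lemma mapEquiv_comp (X X' : CatDiagram F) (Y : CatDiagram G) (f : X ⟶ X')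
    (g : (mapFunctor L).obj X' ⟶ Y) :
    mapEquiv adj X Y ((mapFunctor L).map f ≫ g) = f ≫ mapEquiv adj X' Y g :=
  Hom.ext (funext fun s => (adj s).homEquiv_naturality_left (Hom.app f s) (Hom.app g s))

/-- The functor induced on diagrams by objectwise right adjoints. -/
noncomputable def rightFunctor : CatDiagram G ⥤ CatDiagram F :=
  Adjunction.rightAdjointOfEquiv (F := mapFunctor L) (mapEquiv adj) (mapEquiv_comp adj)

/-- Objectwise adjunctions induce an adjunction on diagrams. -/
noncomputable def mapAdj : mapFunctor L ⊣ rightFunctor adj :=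
  Adjunction.adjunctionOfEquivRight (F := mapFunctor L) (mapEquiv adj) (mapEquiv_comp adj)

lemma mapAdj_homEquiv_app {X : CatDiagram F} {Y : CatDiagram G} (f : (mapFunctor L).obj X ⟶ Y)
    (s : D) : Hom.app ((mapAdj adj).homEquiv X Y f) s =
      (adj s).homEquiv (X.obj s) (Y.obj s) (Hom.app f s) := by
  have h : (mapAdj adj).homEquiv X Y = mapEquiv adj X Y :=
    congrFun (congrFun (Adjunction.mkOfHomEquiv_homEquiv _) X) Y
  rw [h]
  rfl

lemma rightFunctor_map_app {X Y : CatDiagram G} (f : X ⟶ Y) (s : D) :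
    Hom.app ((rightFunctor adj).map f) s = (R s).map (Hom.app f s) := by
  have : Hom.app ((rightFunctor adj).map f) s = (adj s).homEquiv _ _
    (((adj s).homEquiv _ _).symm (𝟙 ((R s).obj (X.obj s))) ≫ Hom.app f s) := rfl
  rw [this, Adjunction.homEquiv_naturality_right, Equiv.apply_symm_apply]
  exact Category.id_comp _

end RightAdjoint

end CatDiagram

/-! ### Direct and inverse indexing categories -/

open MorphismProperty

/-- Comparing degrees gives the relation; a non-identity endomorphism would have to raise the degree
of its own source. -/
lemma IsDirectCategory.exists_wellFounded {D : Type w} [SmallCategory D] (h : IsDirectCategory D) :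
    ∃ r : D → D → Prop, WellFounded r ∧ (∀ ⦃s t⦄, s ≠ t → ¬ r s t → IsEmpty (s ⟶ t)) ∧
      ∀ (s : D) (a : s ⟶ s), a = 𝟙 s := by
  obtain ⟨d, hd⟩ := h
  refine ⟨fun s t => d.obj s < d.obj t, InvImage.wf d.obj Ordinal.lt_wf, fun s t hst hr =>
    ⟨fun a => hr (hd a fun ⟨h, _⟩ => hst h)⟩, fun s a => ?_⟩
  by_contra ha
  exact lt_irrefl _ (hd a fun ⟨_, h⟩ => ha h)

lemma IsInverseCategory.exists_wellFounded {D : Type w} [SmallCategory D]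
    (h : IsInverseCategory D) :
    ∃ r : D → D → Prop, WellFounded r ∧ (∀ ⦃s t⦄, s ≠ t → ¬ r s t → IsEmpty (t ⟶ s)) ∧
      ∀ (s : D) (a : s ⟶ s), a = 𝟙 s := by
  obtain ⟨r, hr, hr', h⟩ := IsDirectCategory.exists_wellFounded h
  exact ⟨fun s t => r (.op s) (.op t), InvImage.wf Opposite.op hr,
    fun s t hst h => ⟨fun a => (hr' (fun e => hst (Opposite.op_injective e)) h).elim a.op⟩,
    fun s a => Quiver.Hom.op_inj (h _ a.op)⟩

/-! ### Diagram model structures and the Quillen equivalence -/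

namespace ModelCatDiagram

open CatDiagram

variable {D : Type w} [SmallCategory D] (M : ModelCatDiagram.{w, v, u} D)

instance isLeftAdjoint_push ⦃s t : D⦄ (a : s ⟶ t) :
    (push M.toPseudofunctor a).IsLeftAdjoint :=
  have ⟨_, adj, _⟩ := M.isLeftQuillen a
  adj.isLeftAdjoint

lemma isQuillenAdjunction_push {s t : D} (a : s ⟶ t) :
    IsQuillenAdjunction (Adjunction.ofIsLeftAdjoint (push M.toPseudofunctor a)) :=
  (M.isLeftQuillen a).isQuillenAdjunction _

/-- The value is a product of maps `a^* p`. The fibration property is tested by lifting, where it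
only requires that `a_*` preserve trivial cofibrations. -/
lemma fibrations_cofreeFunctor_map (s t : D) ⦃x y : M.toPseudofunctor.obj ⟨s⟩⦄ (p : x ⟶ y)
    (hp : fibrations _ p) :
    fibrations _ ((eval M.toPseudofunctor t).map ((cofreeFunctor _ s).map p)) := by
  rw [cofreeFunctor_map_app, ← rlp_eq_of_wfs (trivialCofibrations _) (fibrations _)]
  exact fun _ _ i hi => hasLiftingProperty_cofreeMapApp p i fun a =>
    hasLiftingProperty_of_wfs _ _ ((M.isQuillenAdjunction_push a).map_trivialCofibration i hi) hp

lemma trivialFibrations_cofreeFunctor_map (s t : D) ⦃x y : M.toPseudofunctor.obj ⟨s⟩⦄ (p : x ⟶ y)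
    (hp : trivialFibrations _ p) :
    trivialFibrations _ ((eval M.toPseudofunctor t).map ((cofreeFunctor _ s).map p)) := by
  rw [cofreeFunctor_map_app, ← rlp_eq_of_wfs (cofibrations _) (trivialFibrations _)]
  exact fun _ _ i hi => hasLiftingProperty_cofreeMapApp p i fun a =>
    hasLiftingProperty_of_wfs _ _ ((M.isQuillenAdjunction_push a).map_cofibration i hi) hp

lemma cofibrations_freeFunctor_map (s t : D) ⦃x y : M.toPseudofunctor.obj ⟨s⟩⦄ (i : x ⟶ y)
    (hi : cofibrations _ i) :
    cofibrations _ ((eval M.toPseudofunctor t).map ((freeFunctor _ s).map i)) := by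
  rw [freeFunctor_map_app, ← llp_eq_of_wfs (cofibrations _) (trivialFibrations _)]
  exact fun _ _ p hp => hasLiftingProperty_freeMapApp i p fun a =>
    hasLiftingProperty_of_wfs _ _ ((M.isQuillenAdjunction_push a).map_cofibration i hi) hp

lemma trivialCofibrations_freeFunctor_map (s t : D) ⦃x y : M.toPseudofunctor.obj ⟨s⟩⦄ (i : x ⟶ y)
    (hi : trivialCofibrations _ i) :
    trivialCofibrations _ ((eval M.toPseudofunctor t).map ((freeFunctor _ s).map i)) := by
  rw [freeFunctor_map_app, ← llp_eq_of_wfs (trivialCofibrations _) (fibrations _)]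
  exact fun _ _ p hp => hasLiftingProperty_freeMapApp i p fun a =>
    hasLiftingProperty_of_wfs _ _ ((M.isQuillenAdjunction_push a).map_trivialCofibration i hi) hp

instance : HasColimitsOfSize.{w, w} M.Diagram where
  has_colimits_of_shape _ _ := CatDiagram.hasColimitsOfShape

instance : HasLimitsOfSize.{w, w} M.Diagram where

theorem exists_isDiagramProjective (hD : IsDirectCategory D) :
    ∃ P : ModelCategory M.Diagram, M.IsDiagramProjective P := by
  obtain ⟨r, hr, hr', h⟩ := hD.exists_wellFounded
  have : HasFiniteLimits M.Diagram := hasFiniteLimits_of_hasLimitsOfSize.{w, w} _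
  obtain ⟨P, hW, hFib⟩ := exists_objectwise_projective (freeAdj M.toPseudofunctor)
    (cofreeAdj M.toPseudofunctor) hr (fun s => isIso_freeAdj_unit_app (h s))
    (fun s t hst hrst _ _ i => isIso_freeFunctor_map_app (hr' hst hrst) i)
    M.fibrations_cofreeFunctor_map
  refine ⟨P, fun X Y f => ?_, fun X Y f => ?_⟩
  · simp only [weakEquivalence_iff, hW]; rfl
  · simp only [fibration_iff, hFib]; rfl

theorem exists_isDiagramInjective (hD : IsInverseCategory D) :
    ∃ P : ModelCategory M.Diagram, M.IsDiagramInjective P := by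
  obtain ⟨r, hr, hr', h⟩ := hD.exists_wellFounded
  have : HasFiniteColimits M.Diagram := hasFiniteColimits_of_hasColimitsOfSize.{w, w} _
  obtain ⟨P, hW, hCof⟩ := exists_objectwise_injective (freeAdj M.toPseudofunctor)
    (cofreeAdj M.toPseudofunctor) hr (fun s => isIso_cofreeAdj_counit_app (h s))
    (fun s t hst hrst _ _ i => isIso_cofreeFunctor_map_app (hr' hst hrst) i)
    M.cofibrations_freeFunctor_map
  refine ⟨P, fun X Y f => ?_, fun X Y f => ?_⟩
  · simp only [weakEquivalence_iff, hW]; rfl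
  · simp only [cofibration_iff, hCof]; rfl

instance (s : D) : (eval M.toPseudofunctor s).IsLeftAdjoint := (cofreeAdj _ s).isLeftAdjoint

instance (s : D) : (eval M.toPseudofunctor s).IsRightAdjoint := (freeAdj _ s).isRightAdjoint

section

variable {M} [P : ModelCategory M.Diagram]

lemma IsDiagramProjective.fibrations_iff (hP : M.IsDiagramProjective P) {X Y : M.Diagram}
    (f : X ⟶ Y) : fibrations _ f ↔ ∀ s, fibrations _ (Hom.app f s) := by
  simp only [← HomotopicalAlgebra.fibration_iff, hP.fibration_iff]

lemma IsDiagramInjective.cofibrations_iff (hP : M.IsDiagramInjective P) {X Y : M.Diagram}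
    (f : X ⟶ Y) : cofibrations _ f ↔ ∀ s, cofibrations _ (Hom.app f s) := by
  simp only [← HomotopicalAlgebra.cofibration_iff, hP.cofibration_iff]

lemma IsDiagramProjective.isFibrant_obj (hP : M.IsDiagramProjective P) (X : M.Diagram)
    [IsFibrant X] (s : D) : IsFibrant (X.obj s) :=
  isFibrant_obj_of_isRightAdjoint (F := eval _ s) (fun _ _ f hf => (hP.fibrations_iff f).1 hf s) X

lemma IsDiagramInjective.isCofibrant_obj (hP : M.IsDiagramInjective P) (X : M.Diagram)
    [IsCofibrant X] (s : D) : IsCofibrant (X.obj s) :=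
  isCofibrant_obj_of_isLeftAdjoint (F := eval _ s) (fun _ _ f hf => (hP.cofibrations_iff f).1 hf s) X

lemma IsDiagramProjective.trivialFibrations_iff (hP : M.IsDiagramProjective P) {X Y : M.Diagram}
    (f : X ⟶ Y) : trivialFibrations _ f ↔ ∀ s, trivialFibrations _ (Hom.app f s) := by
  simp only [mem_trivialFibrations_iff, hP.fibration_iff, hP.weakEquivalence_iff, forall_and]

lemma IsDiagramInjective.trivialCofibrations_iff (hP : M.IsDiagramInjective P) {X Y : M.Diagram}
    (f : X ⟶ Y) : trivialCofibrations _ f ↔ ∀ s, trivialCofibrations _ (Hom.app f s) := by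
  simp only [mem_trivialCofibrations_iff, hP.cofibration_iff, hP.weakEquivalence_iff, forall_and]

/-- Projective cofibrations are objectwise cofibrations, because cofree diagrams on trivial
fibrations are objectwise trivial fibrations. -/
lemma IsDiagramProjective.isCofibrant_obj (hP : M.IsDiagramProjective P) (X : M.Diagram)
    [IsCofibrant X] (s : D) : IsCofibrant (X.obj s) := by
  refine isCofibrant_obj_of_isLeftAdjoint (F := eval _ s) (fun _ _ i hi => ?_) X
  rw [← llp_eq_of_wfs (cofibrations _) (trivialFibrations _)]
  exact fun _ _ p hp => ((cofreeAdj _ s).hasLiftingProperty_iff i p).2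
    (hasLiftingProperty_of_wfs _ _ hi ((hP.trivialFibrations_iff _).2 fun t =>
      M.trivialFibrations_cofreeFunctor_map s t p hp))

/-- Dually, injective fibrations are objectwise fibrations, tested against free diagrams on trivial
cofibrations. -/
lemma IsDiagramInjective.isFibrant_obj (hP : M.IsDiagramInjective P) (X : M.Diagram)
    [IsFibrant X] (s : D) : IsFibrant (X.obj s) := by
  refine isFibrant_obj_of_isRightAdjoint (F := eval _ s) (fun _ _ p hp => ?_) X
  rw [← rlp_eq_of_wfs (trivialCofibrations _) (fibrations _)]
  exact fun _ _ i hi => ((freeAdj _ s).hasLiftingProperty_iff i p).1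
    (hasLiftingProperty_of_wfs _ _ ((hP.trivialCofibrations_iff _).2 fun t =>
      M.trivialCofibrations_freeFunctor_map s t i hi) hp)

end

section Map

variable {M} {N : ModelCatDiagram.{w, v, u} D} {L : ModelCatDiagram.Hom M N}
  [P : ModelCategory M.Diagram] [Q : ModelCategory N.Diagram]
  {R : ∀ s : D, N.toPseudofunctor.obj ⟨s⟩ ⥤ M.toPseudofunctor.obj ⟨s⟩}
  {adj : ∀ s, CatDiagram.comp L s ⊣ R s}

/-- Projective cofibrations are not described objectwise, so the Quillen condition is checked on the
right adjoint, which acts objectwise on fibrations and trivial fibrations. -/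
lemma IsDiagramProjective.isQuillenEquivalence (hP : M.IsDiagramProjective P)
    (hQ : N.IsDiagramProjective Q) (hadj : ∀ s, IsQuillenEquivalence (adj s)) :
    IsQuillenEquivalence (mapAdj adj) where
  toIsQuillenAdjunction := .of_right_adjoint
    (fun X Y p hp => by
      rw [hP.fibrations_iff]
      intro s
      rw [rightFunctor_map_app]
      exact (hadj s).map_fibration _ ((hQ.fibrations_iff p).1 hp s))
    (fun X Y p hp => by
      rw [hP.trivialFibrations_iff]
      intro s
      rw [rightFunctor_map_app]
      exact (hadj s).map_trivialFibration _ ((hQ.trivialFibrations_iff p).1 hp s))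
  weakEquivalence_iff X Y _ _ f := by
    rw [hQ.weakEquivalence_iff, hP.weakEquivalence_iff]
    refine forall_congr' fun s => ?_
    rw [mapAdj_homEquiv_app]
    exact (hadj s).weakEquivalence_iff _ _ (hP.isCofibrant_obj X s) (hQ.isFibrant_obj Y s) _

lemma IsDiagramInjective.isQuillenEquivalence (hP : M.IsDiagramInjective P)
    (hQ : N.IsDiagramInjective Q) (hadj : ∀ s, IsQuillenEquivalence (adj s)) :
    IsQuillenEquivalence (mapAdj adj) where
  map_cofibration X Y i hi := by
    rw [hQ.cofibrations_iff]
    intro s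
    exact (hadj s).map_cofibration _ ((hP.cofibrations_iff i).1 hi s)
  map_trivialCofibration X Y i hi := by
    rw [hQ.trivialCofibrations_iff]
    intro s
    exact (hadj s).map_trivialCofibration _ ((hP.trivialCofibrations_iff i).1 hi s)
  weakEquivalence_iff X Y _ _ f := by
    rw [hQ.weakEquivalence_iff, hP.weakEquivalence_iff]
    refine forall_congr' fun s => ?_
    rw [mapAdj_homEquiv_app]
    exact (hadj s).weakEquivalence_iff _ _ (hP.isCofibrant_obj X s) (hQ.isFibrant_obj Y s) _

end Map

end ModelCatDiagram

theorem lemma4p2 {D : Type w} [SmallCategory D] (M N : ModelCatDiagram.{w, v, u} D)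
    (L : ModelCatDiagram.Hom M N)
    (hL : ∀ s : D, IsLeftQuillenEquivalence (L.app ⟨s⟩).toFunctor) :
    (IsDirectCategory D →
      ∃ (P : ModelCategory M.Diagram) (Q : ModelCategory N.Diagram),
        M.IsDiagramProjective P ∧ N.IsDiagramProjective Q ∧
          IsLeftQuillenEquivalence (CatDiagram.mapFunctor L)) ∧
    (IsInverseCategory D →
      ∃ (P : ModelCategory M.Diagram) (Q : ModelCategory N.Diagram),
        M.IsDiagramInjective P ∧ N.IsDiagramInjective Q ∧
          IsLeftQuillenEquivalence (CatDiagram.mapFunctor L)) := by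
  choose R adj hadj using hL
  refine ⟨fun hD => ?_, fun hD => ?_⟩
  · obtain ⟨P, hP⟩ := M.exists_isDiagramProjective hD
    obtain ⟨Q, hQ⟩ := N.exists_isDiagramProjective hD
    exact ⟨P, Q, hP, hQ, _, _, hP.isQuillenEquivalence hQ hadj⟩
  · obtain ⟨P, hP⟩ := M.exists_isDiagramInjective hD
    obtain ⟨Q, hQ⟩ := N.exists_isDiagramInjective hD
    exact ⟨P, Q, hP, hQ, _, _, hP.isQuillenEquivalence hQ hadj⟩
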